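/- A relation algebra is a Boolean algebra with a binary operation $;$ (relative multiplication), a unary operation ${}^\smile$ (converse) and a constant $1'$ (identity) such that $r;(s;t)=(r;s);t$, $r;1'=r$, $r^{\smile\smile}=r$, $(r;s)^\smile=s^\smile;r^\smile$, $(r+s);t=r;t+s;t$, $(r+s)^\smile=r^\smile+s^\smile$ and $r^\smile;-(r;s)\le -s$. A function is an element $f$ with $f^\smile;f\le 1'$. A measurable atom is an atom $x\le 1'$ such that $x;1;x$ is the sum (supremum) of a set of functions, and a relation algebra is measurable if $1'$ is the sum of a set of measurable atoms. Let $I$ be the set of measurable atoms and $\mathcal E=\{(x,y)\in I\times I: x;1;y\ne 0\}$ (an equivalence relation). A scaffold is a system $\langle a_{xy}:(x,y)\in\mathcal E\rangle$ of atoms with $a_{xy}\le x;1;y$, $a_{xx}=x$, $a_{yx}=a_{xy}^\smile$ for all $(x,y)\in\mathcal E$ and $x\in I$, and $a_{xz}\le a_{xy};a_{yz}$ for all $(x,y),(y,z)\in\mathcal E$. A group triple $\mathcal F=(G,\varphi,C)$ over a set $I$ with an equivalence relation $\mathcal E$ consists of pairwise disjoint groups $G_x$ ($x\in I$), isomorphisms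 $\varphi_{xy}:G_x/H_{xy}\to G_y/K_{xy}$ for $(x,y)\in\mathcal E$, where $H_{xy}$ and $K_{xy}$ are normal subgroups of $G_x$ and $G_y$, and cosets $C_{xyz}$ of $H_{xy}H_{xz}$ in $G_x$ for $(x,y),(y,z)\in\mathcal E$. For sets $X\subseteq G_x$ and $Y\subseteq G_y$ write $\varphi_{xy}[X]=\{g\in G_y:\varphi_{xy}(fH_{xy})=gK_{xy}\text{ for some }f\in X\}$ and $\varphi_{xy}^{-1}[Y]=\{f\in G_x:\varphi_{xy}(fH_{xy})=gK_{xy}\text{ for some }g\in Y\}$. The triple is a semi-frame if (i) $\varphi_{xx}$ is the identity automorphism of $G_x/\{e_x\}$; (ii) $\varphi_{yx}=\varphi_{xy}^{-1}$; (iii) $\varphi_{xy}[H_{xy}H_{xz}]=K_{xy}H_{yz}$; (iv) $\varphi_{yz}[\varphi_{xy}[Q]]=\varphi_{xz}[C_{xyz}^{-1}QC_{xyz}]$ for every coset $Q$ of $H_{xy}H_{xz}$ in $G_x$. The group pair $(G,\varphi)$ is a frame if (i)–(iii) hold and $\varphi_{yz}[\varphi_{xy}[Q]]=\varphi_{xz}[Q]$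 for every such $Q$. For $(x,y)\in\mathcal E$ and a coset $\alpha\in G_x/H_{xy}$ let $$R_{xy,\alpha}=\bigcup_{\xi\in G_x/H_{xy}}\xi\times\bigl(\varphi_{xy}(\xi)\varphi_{xy}(\alpha)\bigr).$$ The group relation algebra $\mathfrak G[(G,\varphi)]$ on a frame $(G,\varphi)$ is the set relation algebra consisting of all unions of sets of relations $R_{xy,\alpha}$, with base set $U=\bigcup_x G_x$, unit $\bigcup_{(x,y)\in\mathcal E}G_x\times G_y$, and the operations of union, complement relative to the unit, relational composition, relational converse, and the identity relation on $U$. The shifted operation $\otimes$ on the same set of relations is the completely distributive operation with $R_{xy,\alpha}\otimes R_{wz,\beta}=\varnothing$ if $y\ne w$, and $$R_{xy,\alpha}\otimes R_{yz,\beta}=\bigcup\{R_{xz,\gamma}:\gamma\subseteq\varphi_{xy}^{-1}[\varphi_{xy}(\alpha)\,\beta]\,C_{xyz}\}.$$ Theorem. Let $\mathfrak B$ be a measurable relation algebra with a scaffold $a$. Then there is a group triple $\mathcal F=(G,\varphi,C)$ over the set $I$ of measurable atoms and the relation $\mathcal E$ above that is associated with $a$, in the following sense: up to isomorphism, $G_x$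 is the group, under $;$, of the non-zero functions below $x;1;x$; $H_{xy}=\{f\in G_x:f;a_{xy}=a_{xy}\}$ and $K_{xy}=\{g\in G_y:a_{xy};g=a_{xy}\}$; $\varphi_{xy}(fH_{xy})=gK_{xy}$ if and only if $f;a_{xy}=a_{xy};g$; and $C_{xyz}=H_{xy}(fH_{xz})$ for some $f\in G_x$ with $f;a_{xz}\le a_{xy};a_{yz}$. Moreover, $\mathcal F$ is a semi-frame, $(G,\varphi)$ is a frame, and $\mathfrak B$ is essentially isomorphic to the group relation algebra $\mathfrak G[(G,\varphi)]$: the completion of $\mathfrak B$ (the complete relation algebra in which $\mathfrak B$ is densely embedded) exists and is isomorphic to $\mathfrak G[(G,\varphi)]$. Finally, $R\otimes S$ is the relational composition of $R$ and $S$ for all $R,S$ in $\mathfrak G[(G,\varphi)]$. -/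

import Mathlib

open scoped Pointwise

universe u

/-- A relation algebra: a Boolean algebra with a relative multiplication, a converse and a
distinguished identity element. -/
class RelationAlgebra (A : Type u) extends BooleanAlgebra A where
  rmul : A → A → A
  conv : A → A
  ident : A
  rmul_assoc : ∀ r s t : A, rmul r (rmul s t) = rmul (rmul r s) t
  rmul_ident : ∀ r : A, rmul r ident = r
  conv_conv : ∀ r : A, conv (conv r) = r
  conv_rmul : ∀ r s : A, conv (rmul r s) = rmul (conv s) (conv r)
  sup_rmul : ∀ r s t : A, rmul (r ⊔ s) t = rmul r t ⊔ rmul s t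
  conv_sup : ∀ r s : A, conv (r ⊔ s) = conv r ⊔ conv s
  /-- Tarski's law. -/
  tarski : ∀ r s : A, rmul (conv r) (rmul r s)ᶜ ⊔ sᶜ = sᶜ

infixl:75 " ⨾ " => RelationAlgebra.rmul
postfix:max "˘" => RelationAlgebra.conv

namespace RelationAlgebra

section Abstract

variable {A : Type u} [RelationAlgebra A]

/-- Functional elements. -/
def IsFunctional (f : A) : Prop := f˘ ⨾ f ≤ ident

/-- A measurable atom: a subidentity atom whose square is the (possibly infinite) sum of a set
of functional elements. -/
def IsMeasurableAtom (x : A) : Prop :=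
  IsAtom x ∧ x ≤ ident ∧ ∃ X : Set A, (∀ f ∈ X, IsFunctional f) ∧ IsLUB X (x ⨾ ⊤ ⨾ x)

variable (A) in
/-- The set `I` of measurable atoms, as a type. -/
abbrev MeasAtom : Type u := {x : A // IsMeasurableAtom x}

variable (A) in
/-- A relation algebra is measurable if its identity element is the sum of a set of
measurable atoms. -/
def IsMeasurable : Prop :=
  ∃ X : Set A, (∀ x ∈ X, IsMeasurableAtom x) ∧ IsLUB X (ident : A)

/-- The relation `ℰ` on the set of measurable atoms. -/
def Linked (x y : MeasAtom A) : Prop := x.1 ⨾ ⊤ ⨾ y.1 ≠ ⊥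

/-- A scaffold: a system of atoms indexed by the pairs in `ℰ`. -/
structure IsScaffold (a : ∀ x y : MeasAtom A, Linked x y → A) : Prop where
  atom : ∀ x y (h : Linked x y), IsAtom (a x y h)
  le_rect : ∀ x y (h : Linked x y), a x y h ≤ x.1 ⨾ ⊤ ⨾ y.1
  diag : ∀ x (h : Linked x x), a x x h = x.1
  symm : ∀ x y (h : Linked x y) (h' : Linked y x), a y x h' = (a x y h)˘
  comp : ∀ x y z (hxy : Linked x y) (hyz : Linked y z) (hxz : Linked x z),
    a x z hxz ≤ a x y hxy ⨾ a y z hyz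

/-- The non-zero functions below the square of `x`, i.e. the elements of the group `G_x`. -/
def squareFunctions (x : A) : Set A := {f | f ≠ ⊥ ∧ f ≤ x ⨾ ⊤ ⨾ x ∧ IsFunctional f}

/-- `e` exhibits `A` as a completion (minimal complete extension) of `B`: `A` is complete, `e`
is an embedding of relation algebras, and its image is dense in `A`. -/
structure IsCompletion {B A : Type u} [RelationAlgebra B] [RelationAlgebra A] (e : B → A) :
    Prop where
  injective : Function.Injective e
  map_sup : ∀ r s, e (r ⊔ s) = e r ⊔ e s
  map_compl : ∀ r, e rᶜ = (e r)ᶜ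
  map_rmul : ∀ r s, e (r ⨾ s) = e r ⨾ e s
  map_conv : ∀ r, e r˘ = (e r)˘
  map_ident : e ident = ident
  complete : ∀ X : Set A, ∃ s, IsLUB X s
  dense : ∀ s : A, s ≠ ⊥ → ∃ r : B, r ≠ ⊥ ∧ e r ≤ s

/-- `θ` is an isomorphism from `A` onto the set relation algebra with universe `S`, base set `U`
and unit `E`. The operations of the latter are union, complement relative to `E`, relational
composition, relational inverse and the identity relation on `U`. -/
structure IsSetIso {U : Type u} (θ : A → SetRel U U) (E : SetRel U U)
    (S : Set (SetRel U U)) : Prop where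
  injective : Function.Injective θ
  range_eq : Set.range θ = S
  map_sup : ∀ r s, θ (r ⊔ s) = θ r ∪ θ s
  map_compl : ∀ r, θ rᶜ = E \ θ r
  map_rmul : ∀ r s, θ (r ⨾ s) = (θ r).comp (θ s)
  map_conv : ∀ r, θ r˘ = (θ r).inv
  map_ident : θ ident = SetRel.id

/-- `B` is essentially isomorphic to the set relation algebra with universe `S` and unit `E`:
the completion of `B` exists and is isomorphic to that algebra. -/
def EssentiallyIsomorphic (B : Type u) [RelationAlgebra B] {U : Type u} (E : SetRel U U)
    (S : Set (SetRel U U)) : Prop :=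
  (∃ (A : Type u) (_ : RelationAlgebra A) (e : B → A), IsCompletion e) ∧
  ∀ (A : Type u) [RelationAlgebra A] (e : B → A), IsCompletion e →
    ∃ θ : A → SetRel U U, IsSetIso θ E S

end Abstract

end RelationAlgebra

/-- A group pair over the index set `I`: groups `G x`, an equivalence relation `E` on `I`, and for
each pair in `E` an isomorphism `φ` from the quotient of `G x` by a normal subgroup `H` to the
quotient of `G y` by a normal subgroup `K`. The groups are made disjoint by tagging, see
`GroupPair.Base`. -/
structure GroupPair (I : Type u) where
  G : I → Type u
  [grp : ∀ x, Group (G x)]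
  E : I → I → Prop
  equiv : Equivalence E
  H : ∀ {x y}, E x y → Subgroup (G x)
  K : ∀ {x y}, E x y → Subgroup (G y)
  [normalH : ∀ {x y} (h : E x y), (H h).Normal]
  [normalK : ∀ {x y} (h : E x y), (K h).Normal]
  φ : ∀ {x y} (h : E x y), G x ⧸ H h ≃* G y ⧸ K h

attribute [instance] GroupPair.grp GroupPair.normalH GroupPair.normalK

namespace GroupPair

variable {I : Type u} (F : GroupPair I)

/-- The coset of `H h` named by an element of the quotient, as a subset of `G x`. -/
def cosetH {x y : I} (h : F.E x y) (q : F.G x ⧸ F.H h) : Set (F.G x) :=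
  {f | (f : F.G x ⧸ F.H h) = q}

/-- The coset of `K h` corresponding under `φ` to the coset `q` of `H h`. -/
def cosetK {x y : I} (h : F.E x y) (q : F.G x ⧸ F.H h) : Set (F.G y) :=
  {g | (g : F.G y ⧸ F.K h) = F.φ h q}

/-- The image `φ[X]`: the union of the cosets `φ(Q)`, where `Q` is the coset of an element
of `X`. -/
def image {x y : I} (h : F.E x y) (X : Set (F.G x)) : Set (F.G y) :=
  {g | ∃ f ∈ X, F.φ h (f : F.G x ⧸ F.H h) = (g : F.G y ⧸ F.K h)}

/-- The inverse image `φ⁻¹[Y]`, read in the same way. -/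
def preimage {x y : I} (h : F.E x y) (Y : Set (F.G y)) : Set (F.G x) :=
  {f | ∃ g ∈ Y, F.φ h (f : F.G x ⧸ F.H h) = (g : F.G y ⧸ F.K h)}

/-- The complex product `H_xy ∘ H_xz`. -/
def HH {x y z : I} (hxy : F.E x y) (hyz : F.E y z) : Set (F.G x) :=
  (F.H hxy : Set (F.G x)) * (F.H (F.equiv.trans hxy hyz) : Set (F.G x))

/-- The three conditions common to semi-frames and frames. -/
structure BasicConditions : Prop where
  /-- `φ_xx` is the identity automorphism of `G_x/{e_x}`. -/
  diagH : ∀ x, F.H (F.equiv.refl x) = ⊥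
  diagK : ∀ x, F.K (F.equiv.refl x) = ⊥
  diag : ∀ x (f : F.G x), F.φ (F.equiv.refl x) (f : F.G x ⧸ F.H (F.equiv.refl x)) =
    (f : F.G x ⧸ F.K (F.equiv.refl x))
  /-- `φ_yx` is the inverse of `φ_xy`. -/
  symmH : ∀ {x y} (h : F.E x y), F.H (F.equiv.symm h) = F.K h
  symmK : ∀ {x y} (h : F.E x y), F.K (F.equiv.symm h) = F.H h
  symm : ∀ {x y} (h : F.E x y) (f : F.G x) (g : F.G y),
    F.φ h (f : F.G x ⧸ F.H h) = (g : F.G y ⧸ F.K h) ↔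
      F.φ (F.equiv.symm h) (g : F.G y ⧸ F.H (F.equiv.symm h)) =
        (f : F.G x ⧸ F.K (F.equiv.symm h))
  /-- `φ_xy[H_xy ∘ H_xz] = K_xy ∘ H_yz`. -/
  image_HH : ∀ {x y z} (hxy : F.E x y) (hyz : F.E y z),
    F.image hxy (F.HH hxy hyz) = (F.K hxy : Set (F.G y)) * (F.H hyz : Set (F.G y))

/-- A frame: the isomorphisms induced on quotients by larger subgroups compose, which is stated on
every coset `g ∘ (H_xy ∘ H_xz)` of `H_xy ∘ H_xz`. -/
structure IsFrame : Prop extends F.BasicConditions where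
  comp : ∀ {x y z} (hxy : F.E x y) (hyz : F.E y z) (g : F.G x),
    F.image hyz (F.image hxy (g • F.HH hxy hyz)) =
      F.image (F.equiv.trans hxy hyz) (g • F.HH hxy hyz)

/-- The base set: the disjoint union of the groups. -/
abbrev Base : Type u := Σ x : I, F.G x

/-- The unit: the union of the rectangles `G_x × G_y` over the pairs in `E`. -/
def unit : SetRel F.Base F.Base := {p | F.E p.1.1 p.2.1}

/-- The atomic relation `R_{xy,α}`, the union over all cosets `H_ξ` of `H_ξ × (K_ξ ∘ K_α)`. -/
def atomRel {x y : I} (h : F.E x y) (α : F.G x ⧸ F.H h) : SetRel F.Base F.Base :=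
  {p | ∃ ξ : F.G x ⧸ F.H h, ∃ f ∈ F.cosetH h ξ, ∃ g ∈ F.cosetK h ξ * F.cosetK h α,
    p = (⟨x, f⟩, ⟨y, g⟩)}

/-- The set of all atomic relations. -/
def atomRels : Set (SetRel F.Base F.Base) :=
  {R | ∃ (x y : I) (h : F.E x y) (α : F.G x ⧸ F.H h), R = F.atomRel h α}

/-- The universe of the group relation algebra on `F` (and of the coset relation algebras on
triples extending `F`): all unions of sets of atomic relations. -/
def relUniverse : Set (SetRel F.Base F.Base) :=
  {R | ∃ T ⊆ F.atomRels, R = ⋃₀ T}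

end GroupPair

/-- A group triple: a group pair with a coset `C_xyz` of `H_xy ∘ H_xz` in `G_x` for all pairs
`(x, y)` and `(y, z)` in `E`. -/
structure GroupTriple (I : Type u) extends GroupPair I where
  C : ∀ {x y z}, E x y → E y z → Set (G x)
  C_coset : ∀ {x y z} (hxy : E x y) (hyz : E y z),
    ∃ g : G x, C hxy hyz = g • toGroupPair.HH hxy hyz

namespace GroupTriple

variable {I : Type u} (F : GroupTriple I)

/-- A (coset) semi-frame. The inner automorphism determined by the coset `C` sends a coset `Q`
to `C⁻¹ ∘ Q ∘ C`. -/
structure IsSemiFrame : Prop extends F.toGroupPair.BasicConditions where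
  comp : ∀ {x y z} (hxy : F.E x y) (hyz : F.E y z) (g : F.G x),
    F.image hyz (F.image hxy (g • F.HH hxy hyz)) =
      F.image (F.equiv.trans hxy hyz)
        ((F.C hxy hyz)⁻¹ * (g • F.HH hxy hyz) * F.C hxy hyz)

/-- `R_{xy,α} ⊗ R_{yz,β}`, the union of the `R_{xz,γ}` such that
`H_{xz,γ} ⊆ φ_xy⁻¹[K_{xy,α} ∘ H_{yz,β}] ∘ C_xyz`. -/
def otimesAtom {x y z : I} (hxy : F.E x y) (hyz : F.E y z) (α : F.G x ⧸ F.H hxy)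
    (β : F.G y ⧸ F.H hyz) : SetRel F.Base F.Base :=
  ⋃ γ ∈ {γ : F.G x ⧸ F.H (F.equiv.trans hxy hyz) |
      F.cosetH (F.equiv.trans hxy hyz) γ ⊆
        F.preimage hxy (F.cosetK hxy α * F.cosetH hyz β) * F.C hxy hyz},
    F.atomRel (F.equiv.trans hxy hyz) γ

/-- The shifted operation `⊗`, extended from atoms so as to be completely distributive. Pairs of
atomic relations `R_{xy,α}`, `R_{wz,β}` with `y ≠ w` have empty product and do not contribute. -/
def otimes (R S : SetRel F.Base F.Base) : SetRel F.Base F.Base :=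
  {p | ∃ (x y z : I) (hxy : F.E x y) (hyz : F.E y z) (α : F.G x ⧸ F.H hxy)
    (β : F.G y ⧸ F.H hyz), F.atomRel hxy α ⊆ R ∧ F.atomRel hyz β ⊆ S ∧
      p ∈ F.otimesAtom hxy hyz α β}

open RelationAlgebra in
/-- `F` is the group triple associated with the scaffold `a`, where `ι x` identifies the group
`F.G x` with the group of non-zero functions below the square of `x`. The subgroups are the left
and right stabilizers of the atoms `a_xy`, the isomorphism sends the coset of `f` to the coset of
`g` with `f;a_xy = a_xy;g`, and the shifting coset is `H_xy ∘ H_ζ`, where `H_ζ` is a coset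
of `H_xz` (here that of `f`) with `H_ζ;a_xz ≤ a_xy;a_yz`. -/
structure IsAssociated {B : Type u} [RelationAlgebra B]
    (a : ∀ x y : MeasAtom B, Linked x y → B) (F : GroupTriple (MeasAtom B))
    (ι : ∀ x, F.G x → B) : Prop where
  ι_injective : ∀ x, Function.Injective (ι x)
  ι_range : ∀ x, Set.range (ι x) = squareFunctions x.1
  ι_mul : ∀ x (f g : F.G x), ι x (f * g) = ι x f ⨾ ι x g
  E_iff : ∀ x y, F.E x y ↔ Linked x y
  mem_H : ∀ x y (h : F.E x y) (h' : Linked x y) (f : F.G x),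
    f ∈ F.H h ↔ ι x f ⨾ a x y h' = a x y h'
  mem_K : ∀ x y (h : F.E x y) (h' : Linked x y) (g : F.G y),
    g ∈ F.K h ↔ a x y h' ⨾ ι y g = a x y h'
  φ_iff : ∀ x y (h : F.E x y) (h' : Linked x y) (f : F.G x) (g : F.G y),
    F.φ h (f : F.G x ⧸ F.H h) = (g : F.G y ⧸ F.K h) ↔
      ι x f ⨾ a x y h' = a x y h' ⨾ ι y g
  C_eq : ∀ x y z (hxy : F.E x y) (hyz : F.E y z) (h₁ : Linked x y) (h₂ : Linked y z)
    (h₃ : Linked x z), ∃ f : F.G x, ι x f ⨾ a x z h₃ ≤ a x y h₁ ⨾ a y z h₂ ∧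
      F.C hxy hyz = (F.H hxy : Set (F.G x)) * F.cosetH (F.equiv.trans hxy hyz) f

end GroupTriple

/-! Below every non-zero element of a square x;1;x there is a non-zero function, and these functions
are atoms forming a group G_x. By the cycle laws, G_x therefore acts transitively on the atoms of
each rectangle x;1;y from the left, and G_y from the right. Fixing the scaffold atom a_xy as origin,
its two stabilizers and the correspondence f;a_xy = a_xy;g give H, K and φ.

The scaffold law a_xz ≤ a_xy;a_yz has two effects. First, a_xy;a_yz has as its atoms exactly the
u;a_xz with u in H_xy∘H_xz (`mem_supStabilizer_iff`), which turns the frame conditions into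
inequalities between products of scaffold atoms. Secondly, f = 1 is an admissible choice for the
shifting coset, so C = H_xy∘H_xz. This is a normal subgroup, so conjugation by C is trivial on its
cosets, and the semi-frame and frame conditions coincide.

The representation labels a pair of points f in G_x, g in G_y by the atom f⁻¹;a_xy;g (`cell`) and
sends s to the set of pairs whose label lies below s. Labels compose (`cell_le_rmul_cell`), and
every factorization of a label is realized by an intermediate point (`exists_cell_of_le_rmul`), so
relative multiplication becomes relational composition. The pairs with one given label form one
relation R_{xy,α} (`mem_atomRel_iff`). The algebra is atomic, so a completion is given by sets of
atoms, and the labelling represents any completion. The same two facts about labels identify ⊗ with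
composition. -/

namespace RelationAlgebra

/-! ### Elementary arithmetic of relation algebras and the cycle laws. -/

section Arithmetic

variable {A : Type u} [RelationAlgebra A] {r s t x y : A}

theorem rmul_mono_left (h : r ≤ s) (t : A) : r ⨾ t ≤ s ⨾ t := by
  rw [← sup_eq_right] at h ⊢
  rw [← sup_rmul, h]

theorem conv_mono (h : r ≤ s) : r˘ ≤ s˘ := by
  rw [← sup_eq_right] at h ⊢
  rw [← conv_sup, h]

theorem conv_le_iff : r˘ ≤ s ↔ r ≤ s˘ :=
  ⟨fun h => conv_conv r ▸ conv_mono h, fun h => conv_conv s ▸ conv_mono h⟩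

theorem rmul_mono_right (t : A) (h : r ≤ s) : t ⨾ r ≤ t ⨾ s := by
  rw [← conv_conv (t ⨾ s), ← conv_le_iff, conv_rmul, conv_rmul]
  exact rmul_mono_left (conv_mono h) _

theorem rmul_mono (h : r ≤ s) (h' : x ≤ y) : r ⨾ x ≤ s ⨾ y :=
  (rmul_mono_left h x).trans (rmul_mono_right s h')

theorem conv_injective : Function.Injective (conv : A → A) := fun r s h => by
  rw [← conv_conv r, h, conv_conv]

theorem conv_bot : (⊥ : A)˘ = ⊥ := le_bot_iff.1 (conv_le_iff.2 bot_le)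

theorem conv_top : (⊤ : A)˘ = ⊤ := top_le_iff.1 (conv_le_iff.1 le_top)

theorem conv_ident : (ident : A)˘ = ident := by
  have h : (ident : A)˘ ⨾ ident = ident := by
    apply conv_injective
    rw [conv_rmul, conv_conv, rmul_ident]
  rwa [rmul_ident] at h

theorem ident_rmul (r : A) : ident ⨾ r = r := by
  apply conv_injective
  rw [conv_rmul, conv_ident, rmul_ident]

theorem conv_eq_bot_iff : r˘ = ⊥ ↔ r = ⊥ :=
  ⟨fun h => conv_injective (h.trans conv_bot.symm), fun h => by rw [h, conv_bot]⟩

theorem disjoint_conv_iff : Disjoint r˘ s ↔ Disjoint r s˘ := by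
  have key : ∀ {r s : A}, Disjoint r s˘ → Disjoint r˘ s := fun {r s} h => by
    rw [disjoint_iff_inf_le] at h ⊢
    have h1 : (r˘ ⊓ s)˘ ≤ ⊥ := le_trans
      (le_inf (conv_le_iff.2 inf_le_left) (conv_mono inf_le_right)) h
    rwa [conv_le_iff, conv_bot] at h1
  exact ⟨fun h => (key h.symm).symm, key⟩

/-- The left cycle law. -/
theorem disjoint_rmul_iff_left : Disjoint (r ⨾ s) t ↔ Disjoint (r˘ ⨾ t) s := by
  have key : ∀ {r s t : A}, Disjoint (r ⨾ s) t → Disjoint (r˘ ⨾ t) s := fun {r s t} h => by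
    rw [← le_compl_iff_disjoint_right]
    exact (rmul_mono_right _ (le_compl_iff_disjoint_right.2 h.symm)).trans
      (sup_eq_right.1 (tarski r s))
  exact ⟨key, fun h => by simpa only [conv_conv] using key h⟩

/-- The right cycle law. -/
theorem disjoint_rmul_iff_right : Disjoint (r ⨾ s) t ↔ Disjoint (t ⨾ s˘) r := by
  rw [← conv_conv r, ← conv_conv s, ← conv_rmul, disjoint_conv_iff, disjoint_rmul_iff_left,
    conv_conv, ← disjoint_conv_iff, conv_rmul, conv_conv, conv_conv]

theorem bot_rmul (r : A) : ⊥ ⨾ r = ⊥ :=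
  disjoint_self.1 (disjoint_rmul_iff_right.2 disjoint_bot_right)

theorem rmul_bot (r : A) : r ⨾ ⊥ = ⊥ :=
  disjoint_self.1 (disjoint_rmul_iff_left.2 disjoint_bot_right)

theorem le_of_not_disjoint (hr : IsAtom r) (h : ¬ Disjoint r s) : r ≤ s := by
  rcases hr.le_iff.1 (inf_le_left : r ⊓ s ≤ r) with h' | h'
  · exact absurd (disjoint_iff.2 h') h
  · exact inf_eq_left.1 h'

theorem not_disjoint_of_le (hr : r ≠ ⊥) (h : r ≤ s) : ¬ Disjoint r s := fun hd =>
  hr (disjoint_self.1 (hd.mono_right h))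

theorem eq_of_atoms_not_disjoint (hr : IsAtom r) (hs : IsAtom s) (h : ¬ Disjoint r s) :
    r = s :=
  le_antisymm (le_of_not_disjoint hr h) (le_of_not_disjoint hs fun h' => h h'.symm)

theorem IsAtom.eq_of_le (hr : IsAtom r) (hs : IsAtom s) (h : r ≤ s) : r = s :=
  (hs.le_iff.1 h).resolve_left hr.1

theorem isAtom_conv (hr : IsAtom r) : IsAtom r˘ := by
  refine ⟨fun h => hr.1 (conv_eq_bot_iff.1 h), fun s hs => ?_⟩
  have h : s˘ < r := lt_of_le_of_ne (conv_le_iff.2 hs.le) fun h => hs.ne (by rw [← h, conv_conv])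
  exact conv_eq_bot_iff.1 (hr.2 _ h)

theorem rmul_le_right (hx : x ≤ ident) (r : A) : x ⨾ r ≤ r :=
  (rmul_mono_left hx r).trans (ident_rmul r).le

theorem rmul_le_left (hx : x ≤ ident) (r : A) : r ⨾ x ≤ r :=
  (rmul_mono_right r hx).trans (rmul_ident r).le

/-- The identity splits as x plus its complement below the identity; the second summand annihilates
x, hence also r, so only x contributes to `ident ⨾ r`. -/
theorem rmul_eq_of_le (hx : x ≤ ident) (h : r ≤ x ⨾ ⊤) : x ⨾ r = r := by
  refine le_antisymm (rmul_le_right hx r) ?_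
  have hd : (ident ⊓ xᶜ) ⨾ x = ⊥ := by
    rw [← le_bot_iff, ← inf_compl_self x]
    exact le_inf (rmul_le_right inf_le_left _) ((rmul_le_left hx _).trans inf_le_right)
  have h1 : (ident ⊓ xᶜ) ⨾ r = ⊥ := by
    rw [← le_bot_iff]
    calc (ident ⊓ xᶜ) ⨾ r ≤ (ident ⊓ xᶜ) ⨾ (x ⨾ ⊤) := rmul_mono_right _ h
      _ = ⊥ := by rw [rmul_assoc, hd, bot_rmul]
  have h2 : (x ⊔ ident ⊓ xᶜ) = ident := by
    rw [sup_inf_left, sup_compl_eq_top, inf_top_eq, sup_eq_right.2 hx]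
  calc r = (x ⊔ ident ⊓ xᶜ) ⨾ r := by rw [h2, ident_rmul]
    _ ≤ x ⨾ r := by rw [sup_rmul, h1, sup_bot_eq]

theorem rmul_self_of_le_ident (hi : x ≤ ident) : x ⨾ x = x :=
  rmul_eq_of_le hi (by
    simpa only [rmul_ident] using rmul_mono_right x (le_top : (ident : A) ≤ ⊤))

theorem conv_eq_of_isAtom (hx : IsAtom x) (hi : x ≤ ident) : x˘ = x := by
  have h : x ≤ x˘ := by
    have h2 : ¬ Disjoint (x˘ ⨾ x) x := by
      rw [← disjoint_rmul_iff_left, rmul_self_of_le_ident hi, disjoint_self]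
      exact hx.1
    exact (le_of_not_disjoint hx fun h => h2 h.symm).trans (rmul_le_left hi _)
  exact le_antisymm (conv_le_iff.2 h) h

end Arithmetic

/-! ### Rectangles with measurable atoms as sides. -/

section Rectangles

variable {A : Type u} [RelationAlgebra A]

/-- `r` lies in the rectangle with sides `x` and `y`. -/
def InRect (x y : MeasAtom A) (r : A) : Prop := x.1 ⨾ r = r ∧ r ⨾ y.1 = r

variable {x y z : MeasAtom A} {r s : A}

theorem MeasAtom.isAtom (x : MeasAtom A) : IsAtom x.1 := x.2.1

theorem MeasAtom.le_ident (x : MeasAtom A) : x.1 ≤ ident := x.2.2.1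

theorem MeasAtom.conv_eq (x : MeasAtom A) : x.1˘ = x.1 := conv_eq_of_isAtom x.isAtom x.le_ident

theorem MeasAtom.rmul_self (x : MeasAtom A) : x.1 ⨾ x.1 = x.1 := rmul_self_of_le_ident x.le_ident

theorem MeasAtom.rmul_eq_bot (h : x ≠ y) : x.1 ⨾ y.1 = ⊥ := by
  rw [← le_bot_iff]
  by_contra h'
  apply h
  have hd : ¬ Disjoint x.1 y.1 := fun hd => h' (by
    rw [← disjoint_iff.1 hd]
    exact le_inf (rmul_le_left y.le_ident _) (rmul_le_right x.le_ident _))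
  exact Subtype.ext (eq_of_atoms_not_disjoint x.isAtom y.isAtom hd)

theorem InRect.conv (h : InRect x y r) : InRect y x r˘ := by
  constructor
  · rw [← y.conv_eq, ← conv_rmul, h.2]
  · rw [← x.conv_eq, ← conv_rmul, h.1]

theorem inRect_iff_le : InRect x y r ↔ r ≤ x.1 ⨾ ⊤ ⨾ y.1 := by
  constructor
  · rintro ⟨h1, h2⟩
    calc r = x.1 ⨾ r ⨾ y.1 := by rw [h1, h2]
      _ ≤ _ := rmul_mono_left (rmul_mono_right _ le_top) _
  · intro h
    refine ⟨rmul_eq_of_le x.le_ident (h.trans (rmul_le_left y.le_ident _)), ?_⟩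
    apply conv_injective
    rw [conv_rmul, y.conv_eq]
    apply rmul_eq_of_le y.le_ident
    rw [conv_le_iff, conv_rmul, conv_top, y.conv_eq]
    refine h.trans (rmul_mono_left le_top _)

theorem InRect.mono (h : InRect x y r) (hs : s ≤ r) : InRect x y s :=
  inRect_iff_le.2 (hs.trans (inRect_iff_le.1 h))

theorem InRect.rmul (h : InRect x y r) (h' : InRect y z s) : InRect x z (r ⨾ s) :=
  ⟨by rw [rmul_assoc, h.1], by rw [← rmul_assoc, h'.2]⟩

theorem inRect_self (x : MeasAtom A) : InRect x x x.1 := ⟨x.rmul_self, x.rmul_self⟩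

/-- Since y is an atom it need only meet r˘;r, and the cycle law reduces this to r;y = r ≠ 0. Thus a
non-zero element of a rectangle has full range, which lets r be cancelled. -/
theorem InRect.le_conv_rmul (h : InRect x y r) (hr : r ≠ ⊥) : y.1 ≤ r˘ ⨾ r := by
  apply le_of_not_disjoint y.isAtom
  rw [disjoint_comm, ← disjoint_rmul_iff_left, h.2, disjoint_self]
  exact hr

theorem InRect.le_rmul_conv (h : InRect x y r) (hr : r ≠ ⊥) : x.1 ≤ r ⨾ r˘ := by
  simpa only [conv_conv] using h.conv.le_conv_rmul fun h => hr (conv_eq_bot_iff.1 h)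

theorem InRect.rmul_ne_bot (h : InRect x y r) (h' : InRect y z s) (hr : r ≠ ⊥) (hs : s ≠ ⊥) :
    r ⨾ s ≠ ⊥ := fun h0 => hs (by
  rw [← le_bot_iff]
  calc s = y.1 ⨾ s := h'.1.symm
    _ ≤ r˘ ⨾ r ⨾ s := rmul_mono_left (h.le_conv_rmul hr) s
    _ = ⊥ := by rw [← rmul_assoc, h0, rmul_bot])

theorem linked_iff : Linked x y ↔ ∃ r : A, r ≠ ⊥ ∧ InRect x y r :=
  ⟨fun h => ⟨_, h, inRect_iff_le.2 le_rfl⟩, fun ⟨_, hr, h⟩ h0 =>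
    hr (le_bot_iff.1 ((inRect_iff_le.1 h).trans h0.le))⟩

theorem linked_equivalence : Equivalence (Linked : MeasAtom A → MeasAtom A → Prop) where
  refl x := linked_iff.2 ⟨_, x.isAtom.1, inRect_self x⟩
  symm h := by
    obtain ⟨r, hr, h⟩ := linked_iff.1 h
    exact linked_iff.2 ⟨_, fun h => hr (conv_eq_bot_iff.1 h), h.conv⟩
  trans h h' := by
    obtain ⟨r, hr, h⟩ := linked_iff.1 h
    obtain ⟨s, hs, h'⟩ := linked_iff.1 h'
    exact linked_iff.2 ⟨_, h.rmul_ne_bot h' hr hs, h.rmul h'⟩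

theorem InRect.unique {x' y' : MeasAtom A} (h : InRect x y r) (h' : InRect x' y' r) (hr : r ≠ ⊥) :
    x = x' ∧ y = y' := by
  constructor
  · by_contra hne
    apply hr
    rw [← h.1, ← h'.1, rmul_assoc, MeasAtom.rmul_eq_bot hne, bot_rmul]
  · by_contra hne
    apply hr
    rw [← h'.2, ← h.2, ← rmul_assoc, MeasAtom.rmul_eq_bot hne, rmul_bot]

/-- Every nonzero element of a measurable relation algebra meets some rectangle. -/
theorem IsMeasurable.exists_inRect (hA : IsMeasurable A) (hr : r ≠ ⊥) :
    ∃ (x y : MeasAtom A) (s : A), s ≠ ⊥ ∧ s ≤ r ∧ InRect x y s := by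
  obtain ⟨X, hX, hlub⟩ := hA
  have key : ∀ r : A, r ≠ ⊥ → ∃ x : MeasAtom A, x.1 ⨾ r ≠ ⊥ := by
    intro r hr
    by_contra! h
    -- If every measurable atom annihilates r, each is disjoint from r;r˘ by the cycle law. So is
    -- their supremum, the identity, and the same law then forces r = 0.
    have h1 : (ident : A) ≤ (r ⨾ r˘)ᶜ := hlub.2 fun x hx => by
      rw [le_compl_iff_disjoint_right, disjoint_comm, disjoint_rmul_iff_right, conv_conv,
        h ⟨x, hX x hx⟩]
      exact disjoint_bot_left
    rw [le_compl_iff_disjoint_right, disjoint_comm, disjoint_rmul_iff_right, conv_conv,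
      ident_rmul, disjoint_self] at h1
    exact hr h1
  obtain ⟨x, hx⟩ := key r hr
  obtain ⟨y, hy⟩ := key (x.1 ⨾ r)˘ (fun h => hx (conv_eq_bot_iff.1 h))
  refine ⟨x, y, x.1 ⨾ r ⨾ y.1, fun h => hy ?_, ?_, ?_, ?_⟩
  · rw [← y.conv_eq, ← conv_rmul, h, conv_bot]
  · exact (rmul_le_left y.le_ident _).trans (rmul_le_right x.le_ident _)
  · rw [rmul_assoc, rmul_assoc, x.rmul_self]
  · rw [← rmul_assoc, y.rmul_self]

end Rectangles

/-! ### The groups of functions and their action on the atoms of rectangles. -/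

section Groups

variable {A : Type u} [RelationAlgebra A] {x y z : MeasAtom A} {p q r : A}

theorem inRect_of_mem_squareFunctions {f : A} (h : f ∈ squareFunctions x.1) : InRect x x f :=
  inRect_iff_le.2 h.2.1

/-- A non-zero g ≤ f has full domain x, so f ≤ g;g˘;f ≤ g;(f˘;f) ≤ g. -/
theorem isAtom_of_mem_squareFunctions {f : A} (h : f ∈ squareFunctions x.1) : IsAtom f := by
  have hf := inRect_of_mem_squareFunctions h
  refine ⟨h.1, fun g hg => ?_⟩
  by_contra hg0
  apply hg.not_ge
  calc f = x.1 ⨾ f := hf.1.symm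
    _ ≤ g ⨾ g˘ ⨾ f := rmul_mono_left ((hf.mono hg.le).le_rmul_conv hg0) f
    _ ≤ g ⨾ f˘ ⨾ f := rmul_mono_left (rmul_mono_right _ (conv_mono hg.le)) f
    _ = g ⨾ (f˘ ⨾ f) := (rmul_assoc _ _ _).symm
    _ ≤ g := rmul_le_left h.2.2 g

/-- The only use of the square being a supremum of functions: one of them must meet r, and being an
atom it lies below r. -/
theorem exists_squareFunction_le (hr : r ≠ ⊥) (h : InRect x x r) :
    ∃ f ∈ squareFunctions x.1, f ≤ r := by
  obtain ⟨X, hX, hlub⟩ := x.2.2.2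
  have h1 : ∃ f ∈ X, ¬ Disjoint f r := by
    by_contra! hd
    apply hr
    have : x.1 ⨾ ⊤ ⨾ x.1 ≤ rᶜ := hlub.2 fun f hf => le_compl_iff_disjoint_right.2 (hd f hf)
    exact disjoint_self.1 (le_compl_iff_disjoint_right.1 ((inRect_iff_le.1 h).trans this))
  obtain ⟨f, hf, hd⟩ := h1
  have hm : f ∈ squareFunctions x.1 :=
    ⟨fun h0 => hd (h0 ▸ disjoint_bot_left), hlub.1 hf, hX f hf⟩
  exact ⟨f, hm, le_of_not_disjoint (isAtom_of_mem_squareFunctions hm) hd⟩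

theorem conv_mem_squareFunctions {f : A} (h : f ∈ squareFunctions x.1) :
    f˘ ∈ squareFunctions x.1 := by
  have ha := isAtom_conv (isAtom_of_mem_squareFunctions h)
  -- The converse is an atom, so the function found below it is the converse itself.
  obtain ⟨g, hg, hle⟩ :=
    exists_squareFunction_le ha.1 (inRect_of_mem_squareFunctions h).conv
  rwa [← IsAtom.eq_of_le (isAtom_of_mem_squareFunctions hg) ha hle]

theorem conv_rmul_self_of_mem {f : A} (h : f ∈ squareFunctions x.1) : f˘ ⨾ f = x.1 := by
  have hf := inRect_of_mem_squareFunctions h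
  refine le_antisymm ?_ (hf.le_conv_rmul h.1)
  calc f˘ ⨾ f = f˘ ⨾ f ⨾ x.1 := by rw [← rmul_assoc, hf.2]
    _ ≤ x.1 := rmul_le_right h.2.2 _

theorem rmul_mem_squareFunctions {f g : A} (hf : f ∈ squareFunctions x.1)
    (hg : g ∈ squareFunctions x.1) : f ⨾ g ∈ squareFunctions x.1 := by
  have hf' := inRect_of_mem_squareFunctions hf
  have hg' := inRect_of_mem_squareFunctions hg
  refine ⟨hf'.rmul_ne_bot hg' hf.1 hg.1, inRect_iff_le.1 (hf'.rmul hg'), ?_⟩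
  unfold IsFunctional
  rw [conv_rmul, rmul_assoc, ← rmul_assoc g˘, conv_rmul_self_of_mem hf, hg'.conv.2]
  exact hg.2.2

theorem self_mem_squareFunctions (x : MeasAtom A) : x.1 ∈ squareFunctions x.1 :=
  ⟨x.isAtom.1, inRect_iff_le.1 (inRect_self x), by
    unfold IsFunctional
    rw [x.conv_eq, x.rmul_self]
    exact x.le_ident⟩

/-- The group of non-zero functions below the square of a measurable atom. -/
def AtomGroup (x : MeasAtom A) : Type u := {f : A // f ∈ squareFunctions x.1}

instance (x : MeasAtom A) : Group (AtomGroup x) where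
  mul f g := ⟨f.1 ⨾ g.1, rmul_mem_squareFunctions f.2 g.2⟩
  one := ⟨x.1, self_mem_squareFunctions x⟩
  inv f := ⟨f.1˘, conv_mem_squareFunctions f.2⟩
  mul_assoc f g h := Subtype.ext (rmul_assoc _ _ _).symm
  one_mul f := Subtype.ext (inRect_of_mem_squareFunctions f.2).1
  mul_one f := Subtype.ext (inRect_of_mem_squareFunctions f.2).2
  inv_mul_cancel f := Subtype.ext (conv_rmul_self_of_mem f.2)

namespace AtomGroup

theorem coe_inj {f g : AtomGroup x} : f.1 = g.1 ↔ f = g := Subtype.ext_iff.symm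

theorem coe_mul (f g : AtomGroup x) : (f * g).1 = f.1 ⨾ g.1 := rfl

theorem coe_one : (1 : AtomGroup x).1 = x.1 := rfl

theorem coe_inv (f : AtomGroup x) : (f⁻¹).1 = f.1˘ := rfl

theorem inRect (f : AtomGroup x) : InRect x x f.1 := inRect_of_mem_squareFunctions f.2

theorem isAtom (f : AtomGroup x) : IsAtom f.1 := isAtom_of_mem_squareFunctions f.2

theorem rmul_rmul (f g : AtomGroup x) (r : A) : f.1 ⨾ (g.1 ⨾ r) = (f * g).1 ⨾ r :=
  rmul_assoc _ _ _

theorem rmul_rmul_right (f g : AtomGroup x) (r : A) : r ⨾ f.1 ⨾ g.1 = r ⨾ (f * g).1 :=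
  (rmul_assoc _ _ _).symm

theorem rmul_le_iff (f : AtomGroup x) (hp : InRect x y p) (hq : InRect x y q) :
    f.1 ⨾ p ≤ q ↔ p ≤ f⁻¹.1 ⨾ q := by
  constructor <;> intro h
  · have := rmul_mono_right f⁻¹.1 h
    rwa [rmul_rmul, inv_mul_cancel, coe_one, hp.1] at this
  · have := rmul_mono_right f.1 h
    rwa [rmul_rmul, mul_inv_cancel, coe_one, hq.1] at this

theorem rmul_eq_iff (f : AtomGroup x) (hp : InRect x y p) (hq : InRect x y q) :
    f.1 ⨾ p = q ↔ p = f⁻¹.1 ⨾ q := by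
  constructor <;> rintro rfl
  · rw [rmul_rmul, inv_mul_cancel, coe_one, hp.1]
  · rw [rmul_rmul, mul_inv_cancel, coe_one, hq.1]

theorem rmul_eq_iff_right (g : AtomGroup y) (hp : InRect x y p) (hq : InRect x y q) :
    p ⨾ g.1 = q ↔ p = q ⨾ g⁻¹.1 := by
  constructor <;> rintro rfl
  · rw [rmul_rmul_right, mul_inv_cancel, coe_one, hp.2]
  · rw [rmul_rmul_right, inv_mul_cancel, coe_one, hq.2]

/-- Left translation is invertible on the rectangle, with inverse the translation by f⁻¹, and both
are monotone. -/
theorem isAtom_rmul (f : AtomGroup x) (hp : InRect x y p) (h : IsAtom p) :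
    IsAtom (f.1 ⨾ p) := by
  refine ⟨f.inRect.rmul_ne_bot hp f.isAtom.1 h.1, fun b hb => ?_⟩
  have hbr : InRect x y b := (f.inRect.rmul hp).mono hb.le
  by_contra hb0
  have h1 : f⁻¹.1 ⨾ b = p := by
    refine (h.le_iff.1 ?_).resolve_left (f⁻¹.inRect.rmul_ne_bot hbr f⁻¹.isAtom.1 hb0)
    rw [rmul_le_iff _ hbr hp, inv_inv]
    exact hb.le
  apply hb.ne
  rw [rmul_eq_iff _ hbr hp, inv_inv] at h1
  exact h1

theorem isAtom_rmul_right (g : AtomGroup y) (hp : InRect x y p) (h : IsAtom p) :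
    IsAtom (p ⨾ g.1) := by
  have := isAtom_conv (g⁻¹.isAtom_rmul hp.conv (isAtom_conv h))
  rwa [coe_inv, ← conv_rmul, conv_conv] at this

end AtomGroup

/-- A function below the non-zero element p;q˘ moves q onto p by the cycle law. When p and q are
atoms this becomes transitivity of the action. -/
theorem exists_rmul_not_disjoint (hp : InRect x y p) (hq : InRect x y q) (hp0 : p ≠ ⊥)
    (hq0 : q ≠ ⊥) : ∃ f : AtomGroup x, ¬ Disjoint (f.1 ⨾ q) p := by
  have hq' : q˘ ≠ ⊥ := fun h => hq0 (conv_eq_bot_iff.1 h)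
  obtain ⟨f, hf, hle⟩ := exists_squareFunction_le (hp.rmul_ne_bot hq.conv hp0 hq')
    (hp.rmul hq.conv)
  refine ⟨⟨f, hf⟩, ?_⟩
  rw [disjoint_rmul_iff_right, disjoint_comm]
  exact not_disjoint_of_le hf.1 hle

theorem exists_rmul_le (hp : InRect x y p) (hq : InRect x y q) (hp0 : p ≠ ⊥)
    (ha : IsAtom q) : ∃ f : AtomGroup x, f.1 ⨾ q ≤ p := by
  obtain ⟨f, hf⟩ := exists_rmul_not_disjoint hp hq hp0 ha.1
  exact ⟨f, le_of_not_disjoint (f.isAtom_rmul hq ha) hf⟩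

theorem exists_rmul_eq (hp : InRect x y p) (hq : InRect x y q) (hpa : IsAtom p)
    (hqa : IsAtom q) : ∃ f : AtomGroup x, f.1 ⨾ q = p := by
  obtain ⟨f, hf⟩ := exists_rmul_le hp hq hpa.1 hqa
  exact ⟨f, IsAtom.eq_of_le (f.isAtom_rmul hq hqa) hpa hf⟩

theorem exists_rmul_eq_right (hp : InRect x y p) (hq : InRect x y q) (hpa : IsAtom p)
    (hqa : IsAtom q) : ∃ g : AtomGroup y, q ⨾ g.1 = p := by
  obtain ⟨f, hf⟩ := exists_rmul_eq hp.conv hq.conv (isAtom_conv hpa) (isAtom_conv hqa)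
  refine ⟨f⁻¹, conv_injective ?_⟩
  rw [conv_rmul, AtomGroup.coe_inv, conv_conv, hf]

/-- The atoms below `q ⨾ q˘ ⨾ r` are the translates of `r` by the stabilizer of `q`. -/
theorem exists_stabilizer {r p : A} (hq : InRect x y q) (hqa : IsAtom q) (hr : InRect x z r)
    (hra : IsAtom r) (hpa : IsAtom p) (h : p ≤ q ⨾ q˘ ⨾ r) :
    ∃ k : AtomGroup x, k.1 ⨾ q = q ∧ k.1 ⨾ r = p := by
  have hd : ¬ Disjoint (q ⨾ q˘ ⨾ r) p := fun hd => not_disjoint_of_le hpa.1 h hd.symm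
  -- The cycle law makes p;r˘ meet q;q˘. A function k below both satisfies both demands: from the
  -- first, k;r meets p, and from the second, k;q meets q; all of these are atoms.
  rw [disjoint_rmul_iff_right, disjoint_iff] at hd
  obtain ⟨k, hk, hle⟩ := exists_squareFunction_le hd ((hq.rmul hq.conv).mono inf_le_right)
  refine ⟨⟨k, hk⟩, ?_, ?_⟩
  · refine eq_of_atoms_not_disjoint (AtomGroup.isAtom_rmul ⟨k, hk⟩ hq hqa) hqa ?_
    rw [disjoint_rmul_iff_right, disjoint_comm]
    exact not_disjoint_of_le hk.1 (hle.trans inf_le_right)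
  · refine eq_of_atoms_not_disjoint (AtomGroup.isAtom_rmul ⟨k, hk⟩ hr hra) hpa ?_
    rw [disjoint_rmul_iff_right, disjoint_comm]
    exact not_disjoint_of_le hk.1 (hle.trans inf_le_left)

/-- The left stabilizer of an element of a rectangle. -/
def leftStabilizer (hq : InRect x y q) : Subgroup (AtomGroup x) where
  carrier := {f | f.1 ⨾ q = q}
  mul_mem' {f g} hf hg := by
    simp only [Set.mem_ofPred_eq] at hf hg ⊢
    rw [← AtomGroup.rmul_rmul, hg, hf]
  one_mem' := hq.1
  inv_mem' {f} hf := ((f.rmul_eq_iff hq hq).1 hf).symm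

/-- The right stabilizer of an element of a rectangle. -/
def rightStabilizer (hq : InRect x y q) : Subgroup (AtomGroup y) where
  carrier := {g | q ⨾ g.1 = q}
  mul_mem' {f g} hf hg := by
    simp only [Set.mem_ofPred_eq] at hf hg ⊢
    rw [← AtomGroup.rmul_rmul_right, hf, hg]
  one_mem' := hq.2
  inv_mem' {g} hg := ((g.rmul_eq_iff_right hq hq).1 hg).symm

theorem mem_leftStabilizer {hq : InRect x y q} {f : AtomGroup x} :
    f ∈ leftStabilizer hq ↔ f.1 ⨾ q = q := Iff.rfl

theorem mem_rightStabilizer {hq : InRect x y q} {g : AtomGroup y} :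
    g ∈ rightStabilizer hq ↔ q ⨾ g.1 = q := Iff.rfl

theorem exists_intertwining_right (hq : InRect x y q) (ha : IsAtom q) (f : AtomGroup x) :
    ∃ g : AtomGroup y, f.1 ⨾ q = q ⨾ g.1 := by
  obtain ⟨g, hg⟩ := exists_rmul_eq_right (f.inRect.rmul hq) hq (f.isAtom_rmul hq ha) ha
  exact ⟨g, hg.symm⟩

theorem exists_intertwining_left (hq : InRect x y q) (ha : IsAtom q) (g : AtomGroup y) :
    ∃ f : AtomGroup x, f.1 ⨾ q = q ⨾ g.1 :=
  exists_rmul_eq (hq.rmul g.inRect) hq (g.isAtom_rmul_right hq ha) ha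

/-- On q, left translation by g⁻¹ can be traded for a right translation, which commutes with left
translation by f. -/
theorem leftStabilizer_normal (hq : InRect x y q) (ha : IsAtom q) :
    (leftStabilizer hq).Normal where
  conj_mem f hf g := by
    obtain ⟨k, hk⟩ := exists_intertwining_right hq ha g⁻¹
    rw [mem_leftStabilizer] at hf ⊢
    rw [← AtomGroup.rmul_rmul, hk, ← AtomGroup.rmul_rmul, rmul_assoc f.1, hf, ← hk,
      AtomGroup.rmul_rmul, mul_inv_cancel]
    exact hq.1

theorem rightStabilizer_normal (hq : InRect x y q) (ha : IsAtom q) :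
    (rightStabilizer hq).Normal where
  conj_mem f hf g := by
    obtain ⟨k, hk⟩ := exists_intertwining_left hq ha g
    rw [mem_rightStabilizer] at hf ⊢
    rw [← AtomGroup.rmul_rmul_right, ← AtomGroup.rmul_rmul_right, ← hk, ← rmul_assoc k.1, hf, hk,
      AtomGroup.rmul_rmul_right, mul_inv_cancel]
    exact hq.2

theorem mk_eq_mk_iff_left (hq : InRect x y q) (f f' : AtomGroup x) :
    (f : AtomGroup x ⧸ leftStabilizer hq) = f' ↔ f.1 ⨾ q = f'.1 ⨾ q := by
  rw [QuotientGroup.eq, mem_leftStabilizer, ← AtomGroup.rmul_rmul,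
    AtomGroup.rmul_eq_iff _ (f'.inRect.rmul hq) hq, inv_inv, eq_comm]

theorem mk_eq_mk_iff_right (hq : InRect x y q) (ha : IsAtom q) (g g' : AtomGroup y) :
    (g : AtomGroup y ⧸ rightStabilizer hq) = g' ↔ q ⨾ g.1 = q ⨾ g'.1 := by
  rw [QuotientGroup.eq, (rightStabilizer_normal hq ha).mem_comm_iff, mem_rightStabilizer,
    ← AtomGroup.rmul_rmul_right, AtomGroup.rmul_eq_iff_right _ (hq.rmul g'.inRect) hq, inv_inv,
    eq_comm]

/-! ### The isomorphism between the quotients by the two stabilizers of an atom. -/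

section Isomorphism

variable (hq : InRect x y q) (ha : IsAtom q)

/-- The function sending `f` to an element `g` with `f ⨾ q = q ⨾ g`. -/
noncomputable def transfer (f : AtomGroup x) : AtomGroup y :=
  (exists_intertwining_right hq ha f).choose

theorem transfer_spec (f : AtomGroup x) : f.1 ⨾ q = q ⨾ (transfer hq ha f).1 :=
  (exists_intertwining_right hq ha f).choose_spec

theorem mk_transfer_eq_iff (f : AtomGroup x) (g : AtomGroup y) :
    (transfer hq ha f : AtomGroup y ⧸ rightStabilizer hq) = g ↔ f.1 ⨾ q = q ⨾ g.1 := by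
  rw [mk_eq_mk_iff_right hq ha, ← transfer_spec hq ha f]

/-- The homomorphism to the quotient by the right stabilizer induced by an atom. -/
noncomputable def transferHom :
    letI := rightStabilizer_normal hq ha
    AtomGroup x →* AtomGroup y ⧸ rightStabilizer hq :=
  letI := rightStabilizer_normal hq ha
  MonoidHom.mk' (fun f => (transfer hq ha f : AtomGroup y ⧸ rightStabilizer hq)) fun f g => by
    rw [← QuotientGroup.mk_mul, mk_transfer_eq_iff, ← AtomGroup.rmul_rmul,
      transfer_spec hq ha g, rmul_assoc, transfer_spec hq ha f, AtomGroup.rmul_rmul_right]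

theorem transferHom_eq_iff (f : AtomGroup x) (g : AtomGroup y) :
    transferHom hq ha f = (g : AtomGroup y ⧸ rightStabilizer hq) ↔ f.1 ⨾ q = q ⨾ g.1 :=
  mk_transfer_eq_iff hq ha f g

theorem transferHom_surjective : Function.Surjective (transferHom hq ha) := by
  intro g
  obtain ⟨g, rfl⟩ := QuotientGroup.mk_surjective g
  obtain ⟨f, hf⟩ := exists_intertwining_left hq ha g
  exact ⟨f, (transferHom_eq_iff hq ha f g).2 hf⟩

theorem ker_transferHom :
    letI := rightStabilizer_normal hq ha
    leftStabilizer hq = (transferHom hq ha).ker := by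
  have := rightStabilizer_normal hq ha
  ext f
  rw [MonoidHom.mem_ker, ← QuotientGroup.mk_one, transferHom_eq_iff, mem_leftStabilizer,
    AtomGroup.coe_one, hq.2]

/-- The isomorphism of quotients by the stabilizers of an atom. -/
noncomputable def stabilizerEquiv :
    letI := rightStabilizer_normal hq ha
    letI := leftStabilizer_normal hq ha
    AtomGroup x ⧸ leftStabilizer hq ≃* AtomGroup y ⧸ rightStabilizer hq :=
  letI := rightStabilizer_normal hq ha
  letI := leftStabilizer_normal hq ha
  (QuotientGroup.quotientMulEquivOfEq (ker_transferHom hq ha)).trans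
    (QuotientGroup.quotientKerEquivOfSurjective _ (transferHom_surjective hq ha))

theorem stabilizerEquiv_eq_iff (f : AtomGroup x) (g : AtomGroup y) :
    stabilizerEquiv hq ha (f : AtomGroup x ⧸ leftStabilizer hq) =
      (g : AtomGroup y ⧸ rightStabilizer hq) ↔ f.1 ⨾ q = q ⨾ g.1 :=
  transferHom_eq_iff hq ha f g

end Isomorphism

end Groups

end RelationAlgebra

theorem Subgroup.Normal.inv_mul_smul_mul {G : Type*} [Group G] {N : Subgroup G} (hN : N.Normal)
    (g : G) : (N : Set G)⁻¹ * (g • (N : Set G)) * (N : Set G) = g • (N : Set G) := by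
  ext u
  rw [inv_coe_set]
  constructor
  · rintro ⟨_, ⟨n, hn, _, ⟨m, hm, rfl⟩, rfl⟩, k, hk, rfl⟩
    refine ⟨g⁻¹ * n * g * m * k, N.mul_mem (N.mul_mem ?_ hm) hk, ?_⟩
    · simpa using hN.conj_mem n hn g⁻¹
    · simp [mul_assoc]
  · rintro ⟨m, hm, rfl⟩
    exact ⟨g • m, ⟨1, N.one_mem, g • m, ⟨m, hm, rfl⟩, one_mul _⟩, 1, N.one_mem, mul_one _⟩

namespace RelationAlgebra

/-! ### The group pair and group triple of a scaffold, and the frame conditions. -/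

section Frame

variable {B : Type u} [RelationAlgebra B] {a : ∀ x y : MeasAtom B, Linked x y → B}

namespace IsScaffold

variable {x y z : MeasAtom B}

theorem inRect (ha : IsScaffold a) (h : Linked x y) : InRect x y (a x y h) := inRect_iff_le.2
    (ha.le_rect x y h)

theorem symm' (ha : IsScaffold a) (h : Linked x y) : a y x (linked_equivalence.symm h) =
    (a x y h)˘ :=
  ha.symm x y h _

/-- A product of two scaffold atoms is the sum of the translates of the third atom by the
stabilizer of the first one. -/
theorem exists_of_le_comp (ha : IsScaffold a) {p : B} (hp : IsAtom p) (hxy : Linked x y)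
    (hyz : Linked y z)
    (hxz : Linked x z) (h : p ≤ a x y hxy ⨾ a y z hyz) :
    ∃ k : AtomGroup x, k.1 ⨾ a x y hxy = a x y hxy ∧ k.1 ⨾ a x z hxz = p := by
  refine exists_stabilizer (ha.inRect hxy) (ha.atom _ _ _) (ha.inRect hxz) (ha.atom _ _ _) hp
    (h.trans ?_)
  -- The scaffold law for y, x, z bounds a_yz by a_xy˘;a_xz, which puts the product into the form
  -- treated by `exists_stabilizer`.
  rw [← rmul_assoc, ← ha.symm' hxy]
  exact rmul_mono_right _ (ha.comp _ _ _ _ _ _)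

end IsScaffold

/-- Invert f and g, then take converses: f⁻¹;a_xy = a_xy;g⁻¹ becomes a_yx;f = g;a_yx. -/
theorem intertwining_symm (ha : IsScaffold a) {x y : MeasAtom B} (h : Linked x y)
    (f : AtomGroup x) (g : AtomGroup y) :
    f.1 ⨾ a x y h = a x y h ⨾ g.1 ↔
      g.1 ⨾ a y x (linked_equivalence.symm h) = a y x (linked_equivalence.symm h) ⨾ f.1 := by
  rw [ha.symm' h, AtomGroup.rmul_eq_iff _ (ha.inRect h) ((ha.inRect h).rmul g.inRect), rmul_assoc,
    eq_comm, AtomGroup.rmul_eq_iff_right _ (f⁻¹.inRect.rmul (ha.inRect h)) (ha.inRect h),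
    ← conv_injective.eq_iff, conv_rmul, conv_rmul, AtomGroup.coe_inv, AtomGroup.coe_inv,
    conv_conv, conv_conv, eq_comm]

/-- The group pair associated with a scaffold. -/
noncomputable abbrev scaffoldPair (ha : IsScaffold a) : GroupPair (MeasAtom B) where
  G x := AtomGroup x
  E := Linked
  equiv := linked_equivalence
  H h := leftStabilizer (ha.inRect h)
  K h := rightStabilizer (ha.inRect h)
  normalH h := leftStabilizer_normal _ (ha.atom _ _ h)
  normalK h := rightStabilizer_normal _ (ha.atom _ _ h)
  φ h := stabilizerEquiv (ha.inRect h) (ha.atom _ _ h)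

section Pair

variable (ha : IsScaffold a) {x y z : MeasAtom B}

theorem mem_scaffoldPair_H (h : Linked x y) (f : AtomGroup x) :
    f ∈ (scaffoldPair ha).H h ↔ f.1 ⨾ a x y h = a x y h := Iff.rfl

theorem mem_scaffoldPair_K (h : Linked x y) (g : AtomGroup y) :
    g ∈ (scaffoldPair ha).K h ↔ a x y h ⨾ g.1 = a x y h := Iff.rfl

theorem scaffoldPair_φ_iff (h : Linked x y) (f : AtomGroup x) (g : AtomGroup y) :
    (scaffoldPair ha).φ h (QuotientGroup.mk f) = QuotientGroup.mk g ↔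
      f.1 ⨾ a x y h = a x y h ⨾ g.1 :=
  stabilizerEquiv_eq_iff (ha.inRect h) (ha.atom _ _ h) f g

/-- The subgroup whose carrier is the complex product `HH`. -/
noncomputable def supStabilizer (hxy : Linked x y) (hyz : Linked y z) : Subgroup (AtomGroup x) :=
  leftStabilizer (ha.inRect hxy) ⊔ leftStabilizer (ha.inRect (linked_equivalence.trans hxy hyz))

theorem supStabilizer_normal (hxy : Linked x y) (hyz : Linked y z) :
    (supStabilizer ha hxy hyz).Normal :=
  have := leftStabilizer_normal (ha.inRect hxy) (ha.atom _ _ _)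
  have := leftStabilizer_normal (ha.inRect (linked_equivalence.trans hxy hyz)) (ha.atom _ _ _)
  Subgroup.sup_normal _ _

theorem coe_supStabilizer (hxy : Linked x y) (hyz : Linked y z) :
    (supStabilizer ha hxy hyz : Set (AtomGroup x)) = (scaffoldPair ha).HH hxy hyz :=
  have := leftStabilizer_normal (ha.inRect (linked_equivalence.trans hxy hyz)) (ha.atom _ _ _)
  Subgroup.mul_normal _ _

/-- The bridge between groups and algebra. For u = hk, the factor k is absorbed by a_xz and h by
a_xy, leaving the scaffold law. Conversely, an atom u;a_xz below the product equals k;a_xz with k in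
H_xy, so k⁻¹u fixes a_xz. -/
theorem mem_supStabilizer_iff (hxy : Linked x y) (hyz : Linked y z) (u : AtomGroup x) :
    u ∈ supStabilizer ha hxy hyz ↔
      u.1 ⨾ a x z (linked_equivalence.trans hxy hyz) ≤ a x y hxy ⨾ a y z hyz := by
  rw [← SetLike.mem_coe, coe_supStabilizer]
  constructor
  · rintro ⟨h, hh, k, hk, rfl⟩
    change (h * k : AtomGroup x).1 ⨾ _ ≤ _
    rw [SetLike.mem_coe, mem_scaffoldPair_H] at hh hk
    rw [← AtomGroup.rmul_rmul, hk, ← hh, ← rmul_assoc]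
    exact rmul_mono_right _ (ha.comp _ _ _ _ _ _)
  · intro h
    obtain ⟨k, hk, hk'⟩ := ha.exists_of_le_comp
      (u.isAtom_rmul (ha.inRect _) (ha.atom _ _ _)) hxy hyz
      (linked_equivalence.trans hxy hyz) h
    refine ⟨k, hk, k⁻¹ * u, ?_, mul_inv_cancel_left k u⟩
    rw [SetLike.mem_coe, mem_scaffoldPair_H, ← AtomGroup.rmul_rmul, ← hk', AtomGroup.rmul_rmul,
      inv_mul_cancel]
    exact (ha.inRect _).1

/-- The intertwining relation across two scaffold atoms agrees with that of their composite up to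
the subgroup `HH`. -/
theorem mul_inv_mem_supStabilizer (hxy : Linked x y) (hyz : Linked y z) {f v : AtomGroup x}
    {m : AtomGroup y} {w : AtomGroup z} (h₁ : f.1 ⨾ a x y hxy = a x y hxy ⨾ m.1)
    (h₂ : m.1 ⨾ a y z hyz = a y z hyz ⨾ w.1)
    (h₃ : v.1 ⨾ a x z (linked_equivalence.trans hxy hyz) =
      a x z (linked_equivalence.trans hxy hyz) ⨾ w.1) :
    f⁻¹ * v ∈ supStabilizer ha hxy hyz := by
  rw [mem_supStabilizer_iff, ← AtomGroup.rmul_rmul, h₃,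
    AtomGroup.rmul_le_iff _ ((ha.inRect _).rmul w.inRect) ((ha.inRect _).rmul (ha.inRect _)),
    inv_inv, rmul_assoc, h₁, ← rmul_assoc, h₂, rmul_assoc]
  exact rmul_mono_left (ha.comp _ _ _ _ _ _) _

theorem mem_smul_supStabilizer_iff (hxy : Linked x y) (hyz : Linked y z) (g f : AtomGroup x) :
    f ∈ g • (supStabilizer ha hxy hyz : Set (AtomGroup x)) ↔
      g⁻¹ * f ∈ supStabilizer ha hxy hyz :=
  Set.mem_smul_set_iff_inv_smul_mem

/-- If f is in H_xy∘H_xz and corresponds to g, then a_xz ≤ a_xy;g;a_yz. The cycle law turns this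
into g;a_yz ≤ a_yx;a_xz, which factors g through H_yx = K_xy and H_yz. -/
theorem image_HH_subset (hxy : Linked x y) (hyz : Linked y z) :
    (scaffoldPair ha).image hxy ((scaffoldPair ha).HH hxy hyz) ⊆
      ((scaffoldPair ha).K hxy : Set (AtomGroup y)) *
        ((scaffoldPair ha).H hyz : Set (AtomGroup y)) := by
  rintro g ⟨f, hf, hfg⟩
  change AtomGroup y at g
  change AtomGroup x at f
  rw [scaffoldPair_φ_iff] at hfg
  rw [← coe_supStabilizer] at hf
  -- Membership of the inverse is what leaves f on the right-hand side, where it can be exchanged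
  -- for g.
  have hf' := (supStabilizer ha hxy hyz).inv_mem hf
  rw [mem_supStabilizer_iff, AtomGroup.rmul_le_iff _ (ha.inRect _)
    ((ha.inRect _).rmul (ha.inRect _)), inv_inv, rmul_assoc, hfg, ← rmul_assoc] at hf'
  have hga := g.isAtom_rmul (ha.inRect hyz) (ha.atom _ _ hyz)
  have hd : g.1 ⨾ a y z hyz ≤ a y x (linked_equivalence.symm hxy) ⨾
      a x z (linked_equivalence.trans hxy hyz) := by
    apply le_of_not_disjoint hga
    rw [ha.symm' hxy, disjoint_comm, ← disjoint_rmul_iff_left, disjoint_comm]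
    exact not_disjoint_of_le (ha.atom _ _ _).1 hf'
  obtain ⟨k, hk, hk'⟩ := ha.exists_of_le_comp hga _ _ hyz hd
  refine ⟨k, ?_, k⁻¹ * g, ?_, mul_inv_cancel_left k g⟩
  · rw [SetLike.mem_coe, mem_scaffoldPair_K]
    rw [ha.symm', AtomGroup.rmul_eq_iff _ (ha.inRect _).conv (ha.inRect _).conv] at hk
    apply conv_injective
    rw [conv_rmul, ← AtomGroup.coe_inv, ← hk]
  · rw [SetLike.mem_coe, mem_scaffoldPair_H, ← AtomGroup.rmul_rmul, ← hk', AtomGroup.rmul_rmul,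
      inv_mul_cancel]
    exact (ha.inRect _).1

theorem scaffoldPair_symmH (h : Linked x y) :
    (scaffoldPair ha).H (linked_equivalence.symm h) = (scaffoldPair ha).K h := by
  ext g
  change AtomGroup y at g
  have := intertwining_symm ha h 1 g
  rw [AtomGroup.coe_one, (ha.inRect _).1, (ha.inRect _).2] at this
  rw [mem_scaffoldPair_H, mem_scaffoldPair_K, ← this, eq_comm]

theorem scaffoldPair_symmK (h : Linked x y) :
    (scaffoldPair ha).K (linked_equivalence.symm h) = (scaffoldPair ha).H h :=
  (scaffoldPair_symmH ha (linked_equivalence.symm h)).symm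

theorem scaffoldPair_basicConditions : (scaffoldPair ha).BasicConditions where
  diagH x := by
    ext f
    change AtomGroup x at f
    rw [mem_scaffoldPair_H, ha.diag, f.inRect.2, Subgroup.mem_bot]
    exact AtomGroup.coe_inj (x := x) (g := 1)
  diagK x := by
    ext f
    change AtomGroup x at f
    rw [mem_scaffoldPair_K, ha.diag, f.inRect.1, Subgroup.mem_bot]
    exact AtomGroup.coe_inj (x := x) (g := 1)
  diag x f := by
    change AtomGroup x at f
    rw [scaffoldPair_φ_iff, ha.diag, f.inRect.1, f.inRect.2]
  symmH h := scaffoldPair_symmH ha h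
  symmK h := scaffoldPair_symmK ha h
  symm h f g := by
    rw [scaffoldPair_φ_iff, scaffoldPair_φ_iff]
    exact intertwining_symm ha h f g
  image_HH {x y z} hxy hyz := by
    refine Set.Subset.antisymm (image_HH_subset ha hxy hyz) ?_
    rw [← scaffoldPair_symmH]
    intro g hg
    change AtomGroup y at g
    obtain ⟨f, hf⟩ := exists_intertwining_left (ha.inRect hxy) (ha.atom _ _ _) g
    refine ⟨f, ?_, (scaffoldPair_φ_iff ha hxy f g).2 hf⟩
    -- The reverse inclusion is the inclusion already proved for y, x, z, because φ_yx inverts φ_xy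
    -- and K_xy∘H_yz is the complex product attached to that triple.
    have h := image_HH_subset ha (linked_equivalence.symm hxy)
      (linked_equivalence.trans hxy hyz)
      ⟨g, hg, (scaffoldPair_φ_iff ha _ g f).2 ((intertwining_symm ha hxy f g).1 hf)⟩
    rwa [scaffoldPair_symmK] at h

/-- Carrying an element of G_z back to G_x through y or directly gives two elements differing by a
member of H_xy∘H_xz. A coset of that subgroup therefore contains both or neither. -/
theorem scaffoldPair_isFrame : (scaffoldPair ha).IsFrame where
  toBasicConditions := scaffoldPair_basicConditions ha
  comp {x y z} hxy hyz g := by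
    rw [← coe_supStabilizer]
    have hN := supStabilizer_normal ha hxy hyz
    ext w
    change AtomGroup z at w
    constructor
    · rintro ⟨m, ⟨f, hf, hfm⟩, hmw⟩
      change AtomGroup y at m
      rw [scaffoldPair_φ_iff] at hfm hmw
      obtain ⟨v, hv⟩ := exists_intertwining_left
        (ha.inRect (linked_equivalence.trans hxy hyz)) (ha.atom _ _ _) w
      refine ⟨v, ?_, (scaffoldPair_φ_iff ha _ _ _).2 hv⟩
      rw [mem_smul_supStabilizer_iff] at hf ⊢
      have := mul_inv_mem_supStabilizer ha hxy hyz hfm hmw hv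
      simpa [mul_assoc] using mul_mem hf this
    · rintro ⟨v, hv, hvw⟩
      rw [scaffoldPair_φ_iff] at hvw
      obtain ⟨m, hm⟩ := exists_intertwining_left (ha.inRect hyz) (ha.atom _ _ _) w
      obtain ⟨f, hf⟩ := exists_intertwining_left (ha.inRect hxy) (ha.atom _ _ _) m
      refine ⟨m, ⟨f, ?_, (scaffoldPair_φ_iff ha _ _ _).2 hf⟩, (scaffoldPair_φ_iff ha _ _ _).2 hm⟩
      have := mul_inv_mem_supStabilizer ha hxy hyz hf hm hvw
      rw [mem_smul_supStabilizer_iff] at hv ⊢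
      simpa [mul_assoc] using mul_mem hv (inv_mem this)

/-- The group triple associated with a scaffold. -/
noncomputable abbrev scaffoldTriple : GroupTriple (MeasAtom B) where
  toGroupPair := scaffoldPair ha
  C hxy hyz := (scaffoldPair ha).HH hxy hyz
  C_coset _ _ := ⟨1, (one_smul _ _).symm⟩

theorem scaffoldTriple_isSemiFrame : (scaffoldTriple ha).IsSemiFrame where
  toBasicConditions := scaffoldPair_basicConditions ha
  comp {x y z} hxy hyz g := by
    have h : ((scaffoldTriple ha).C hxy hyz)⁻¹ * (g • (scaffoldPair ha).HH hxy hyz) *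
        (scaffoldTriple ha).C hxy hyz = g • (scaffoldPair ha).HH hxy hyz := by
      change ((scaffoldPair ha).HH hxy hyz)⁻¹ * _ * (scaffoldPair ha).HH hxy hyz = _
      rw [← coe_supStabilizer]
      exact (supStabilizer_normal ha hxy hyz).inv_mul_smul_mul g
    exact ((scaffoldPair_isFrame ha).comp hxy hyz g).trans (congrArg _ h.symm)

theorem scaffoldTriple_isAssociated :
    (scaffoldTriple ha).IsAssociated a fun _ f => Subtype.val f where
  ι_injective _ := Subtype.val_injective
  ι_range _ := Subtype.range_val
  ι_mul _ _ _ := rfl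
  E_iff _ _ := Iff.rfl
  mem_H _ _ _ _ _ := Iff.rfl
  mem_K _ _ _ _ _ := Iff.rfl
  φ_iff _ _ h _ f g := scaffoldPair_φ_iff ha h f g
  C_eq x y z hxy hyz h₁ h₂ h₃ := by
    -- For f = 1 the required inequality is the scaffold law itself, and the coset of f is H_xz.
    refine ⟨(1 : AtomGroup x), ?_, ?_⟩
    · rw [AtomGroup.coe_one, (ha.inRect _).1]
      exact ha.comp _ _ _ _ _ _
    · have h : (scaffoldPair ha).cosetH (linked_equivalence.trans hxy hyz)
          (QuotientGroup.mk (1 : AtomGroup x)) =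
          ((scaffoldPair ha).H (linked_equivalence.trans hxy hyz) : Set (AtomGroup x)) := by
        ext f
        have := (scaffoldPair ha).normalH (linked_equivalence.trans hxy hyz)
        exact QuotientGroup.eq_one_iff (N := (scaffoldPair ha).H _) f
      exact congrArg (((scaffoldPair ha).H hxy : Set (AtomGroup x)) * ·) h.symm

end Pair

end Frame

end RelationAlgebra

namespace RelationAlgebra

/-! ### Atoms below joins, complements, products and suprema. -/

section Atoms

variable {A : Type u} [RelationAlgebra A] {p q r s t : A}

theorem atom_le_sup_iff (hp : IsAtom p) : p ≤ s ⊔ t ↔ p ≤ s ∨ p ≤ t := by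
  refine ⟨fun h => ?_, fun h => h.elim le_sup_of_le_left le_sup_of_le_right⟩
  by_contra! hc
  have hs : Disjoint p s := by_contra fun hd => hc.1 (le_of_not_disjoint hp hd)
  exact hc.2 (hs.left_le_of_le_sup_left h)

theorem atom_le_compl_iff (hp : IsAtom p) : p ≤ sᶜ ↔ ¬ p ≤ s := by
  rw [le_compl_iff_disjoint_right]
  exact ⟨fun hd h => not_disjoint_of_le hp.1 h hd,
    fun h => by_contra fun hd => h (le_of_not_disjoint hp hd)⟩

theorem exists_atom_le [IsAtomic A] (hs : s ≠ ⊥) : ∃ p, IsAtom p ∧ p ≤ s :=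
  (IsAtomic.eq_bot_or_exists_atom_le s).resolve_left hs

theorem le_of_forall_atom_le [IsAtomic A] (h : ∀ p, IsAtom p → p ≤ s → p ≤ t) : s ≤ t := by
  by_contra hst
  obtain ⟨p, hp, hle⟩ := exists_atom_le (s := s ⊓ tᶜ) fun h0 =>
    hst (by rwa [← disjoint_iff, disjoint_compl_right_iff] at h0)
  exact (atom_le_compl_iff hp).1 (hle.trans inf_le_right) (h p hp (hle.trans inf_le_left))

/-- Two cycle laws choose the factors in turn: q below s and p;t˘, then r below t and q˘;p. No
completeness is needed. -/
theorem atom_le_rmul_iff [IsAtomic A] (hp : IsAtom p) :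
    p ≤ s ⨾ t ↔ ∃ q r, IsAtom q ∧ IsAtom r ∧ q ≤ s ∧ r ≤ t ∧ p ≤ q ⨾ r := by
  constructor
  · intro h
    have h1 : ¬ Disjoint (s ⨾ t) p := fun hd => not_disjoint_of_le hp.1 h hd.symm
    rw [disjoint_rmul_iff_right, disjoint_iff] at h1
    obtain ⟨q, hq, hle⟩ := exists_atom_le h1
    have h2 := not_disjoint_of_le hq.1 (hle.trans inf_le_left)
    rw [disjoint_comm, ← disjoint_rmul_iff_right, disjoint_rmul_iff_left, disjoint_iff] at h2
    obtain ⟨r, hr, hle'⟩ := exists_atom_le h2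
    have h3 := not_disjoint_of_le hr.1 (hle'.trans inf_le_left)
    rw [disjoint_comm, ← disjoint_rmul_iff_left, disjoint_comm] at h3
    exact ⟨q, r, hq, hr, hle.trans inf_le_right, hle'.trans inf_le_right,
      le_of_not_disjoint hp h3⟩
  · rintro ⟨q, r, -, -, hqs, hrt, h⟩
    exact h.trans (rmul_mono hqs hrt)

theorem atom_le_lub {X : Set A} (hp : IsAtom p) (hs : IsLUB X s) (h : p ≤ s) :
    ∃ q ∈ X, p ≤ q := by
  by_contra! hc
  have : s ≤ pᶜ := hs.2 fun q hq => le_compl_comm.1 ((atom_le_compl_iff hp).2 (hc q hq))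
  exact hp.1 (disjoint_self.1 (le_compl_iff_disjoint_right.1 (h.trans this)))

end Atoms

/-! ### Existence of the completion of an atomic relation algebra. -/

section AtomComplex

variable (B : Type u) [RelationAlgebra B] [IsAtomic B]

/-- The complex algebra of the atom structure of an atomic relation algebra. -/
@[reducible]
def atomComplexAlgebra : RelationAlgebra (Set {p : B // IsAtom p}) where
  rmul S T := {p | ∃ q ∈ S, ∃ r ∈ T, p.1 ≤ q.1 ⨾ r.1}
  conv S := {p | ⟨p.1˘, isAtom_conv p.2⟩ ∈ S}
  ident := {p | p.1 ≤ ident}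
  rmul_assoc R S T := by
    ext p
    constructor
    · rintro ⟨q, hq, t, ⟨r, hr, s, hs, ht⟩, hp⟩
      have h : p.1 ≤ q.1 ⨾ r.1 ⨾ s.1 := by
        rw [← rmul_assoc]
        exact hp.trans (rmul_mono_right _ ht)
      obtain ⟨t', s', ht', hs', hle, hle', hp'⟩ := (atom_le_rmul_iff p.2).1 h
      rw [IsAtom.eq_of_le hs' s.2 hle'] at hp'
      exact ⟨⟨t', ht'⟩, ⟨q, hq, r, hr, hle⟩, s, hs, hp'⟩
    · rintro ⟨t, ⟨q, hq, r, hr, ht⟩, s, hs, hp⟩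
      have h : p.1 ≤ q.1 ⨾ (r.1 ⨾ s.1) := by
        rw [rmul_assoc]
        exact hp.trans (rmul_mono_left ht _)
      obtain ⟨q', t', hq', ht', hle, hle', hp'⟩ := (atom_le_rmul_iff p.2).1 h
      rw [IsAtom.eq_of_le hq' q.2 hle] at hp'
      exact ⟨q, hq, ⟨t', ht'⟩, ⟨r, hr, s, hs, hle'⟩, hp'⟩
  rmul_ident S := by
    ext p
    constructor
    · rintro ⟨q, hq, r, hr, hp⟩
      have h := IsAtom.eq_of_le p.2 q.2 (hp.trans (rmul_le_left hr _))
      rwa [Subtype.ext h]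
    · intro hp
      obtain ⟨q, r, hq, hr, hle, hle', hp'⟩ :=
        (atom_le_rmul_iff p.2).1 (rmul_ident p.1).ge
      rw [IsAtom.eq_of_le hq p.2 hle] at hp'
      exact ⟨p, hp, ⟨r, hr⟩, hle', hp'⟩
  conv_conv S := by
    ext p
    simp only [Set.mem_ofPred_eq, conv_conv, Subtype.coe_eta]
  conv_rmul S T := by
    ext p
    constructor
    · rintro ⟨q, hq, r, hr, hp⟩
      refine ⟨⟨r.1˘, isAtom_conv r.2⟩, ?_, ⟨q.1˘, isAtom_conv q.2⟩, ?_, ?_⟩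
      · simpa only [Set.mem_ofPred_eq, conv_conv, Subtype.coe_eta] using hr
      · simpa only [Set.mem_ofPred_eq, conv_conv, Subtype.coe_eta] using hq
      · rwa [← conv_rmul, ← conv_le_iff]
    · rintro ⟨q, hq, r, hr, hp⟩
      exact ⟨_, hr, _, hq, by rw [← conv_rmul]; exact conv_mono hp⟩
  sup_rmul R S T := by
    ext p
    constructor
    · rintro ⟨q, hq | hq, r, hr, hp⟩
      · exact Or.inl ⟨q, hq, r, hr, hp⟩
      · exact Or.inr ⟨q, hq, r, hr, hp⟩
    · rintro (⟨q, hq, r, hr, hp⟩ | ⟨q, hq, r, hr, hp⟩)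
      · exact ⟨q, Or.inl hq, r, hr, hp⟩
      · exact ⟨q, Or.inr hq, r, hr, hp⟩
  conv_sup R S := rfl
  tarski R S := by
    rw [sup_eq_right]
    rintro p ⟨q, hq, r, hr, hp⟩ hpS
    -- From p ≤ q;r the cycle law gives r ≤ q˘;p, so p in S would put r in the product R;S.
    refine hr ⟨_, hq, p, hpS, le_of_not_disjoint r.2 ?_⟩
    rw [disjoint_comm, ← disjoint_rmul_iff_left, disjoint_comm]
    exact not_disjoint_of_le p.2.1 hp

/-- Atomicity makes an element determined by the atoms below it, and products are determined on
atoms. Density holds because each singleton is the image of its atom. -/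
theorem isCompletion_atomComplex :
    letI := atomComplexAlgebra B
    IsCompletion fun b : B => {p : {p : B // IsAtom p} | p.1 ≤ b} :=
  letI := atomComplexAlgebra B
  { injective := fun b c h => le_antisymm
      (le_of_forall_atom_le fun p hp hb => (Set.ext_iff.1 h ⟨p, hp⟩).1 hb)
      (le_of_forall_atom_le fun p hp hc => (Set.ext_iff.1 h ⟨p, hp⟩).2 hc)
    map_sup := fun b c => by
      ext p
      exact atom_le_sup_iff p.2
    map_compl := fun b => by
      ext p
      exact atom_le_compl_iff p.2
    map_rmul := fun b c => by
      ext p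
      refine (atom_le_rmul_iff p.2).trans ?_
      constructor
      · rintro ⟨q, r, hq, hr, hqb, hrc, hp⟩
        exact ⟨⟨q, hq⟩, hqb, ⟨r, hr⟩, hrc, hp⟩
      · rintro ⟨q, hq, r, hr, hp⟩
        exact ⟨q, r, q.2, r.2, hq, hr, hp⟩
    map_conv := fun b => by
      ext p
      exact conv_le_iff.symm
    map_ident := rfl
    complete := fun X => ⟨sSup X, isLUB_sSup X⟩
    dense := fun S hS => by
      obtain ⟨p, hp⟩ := Set.nonempty_iff_ne_empty.2 hS
      refine ⟨p.1, p.2.1, fun q hq => ?_⟩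
      rwa [Subtype.ext (IsAtom.eq_of_le q.2 p.2 hq)] }

end AtomComplex

/-! ### Atoms of an arbitrary completion: exactly the images of the atoms of the original algebra.
-/

namespace IsCompletion

variable {B A : Type u} [RelationAlgebra B] [RelationAlgebra A] {e : B → A}

theorem map_bot (he : IsCompletion e) : e ⊥ = ⊥ := by
  have h1 : e ⊥ ≤ e ⊤ := by
    rw [← sup_eq_right, ← he.map_sup, sup_eq_right.2 bot_le]
  have h2 : e ⊤ = (e ⊥)ᶜ := by rw [← he.map_compl, compl_bot]
  rw [h2, le_compl_iff_disjoint_right] at h1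
  exact disjoint_self.1 h1

theorem le_iff (he : IsCompletion e) {b c : B} : e b ≤ e c ↔ b ≤ c := by
  rw [← sup_eq_right, ← he.map_sup, he.injective.eq_iff, sup_eq_right]

theorem isAtom (he : IsCompletion e) {p : B} (hp : IsAtom p) : IsAtom (e p) := by
  refine ⟨fun h => hp.1 (he.injective (h.trans he.map_bot.symm)), fun s hs => ?_⟩
  by_contra hs0
  obtain ⟨r, hr, hle⟩ := he.dense s hs0
  have h := (hp.le_iff.1 (he.le_iff.1 (hle.trans hs.le))).resolve_left hr
  exact hs.not_ge (h ▸ hle)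

theorem exists_atom_le (he : IsCompletion e) [IsAtomic B] {s : A}
    (hs : s ≠ ⊥) : ∃ p, IsAtom p ∧ e p ≤ s := by
  obtain ⟨r, hr, hle⟩ := he.dense s hs
  obtain ⟨p, hp, hpr⟩ := RelationAlgebra.exists_atom_le hr
  exact ⟨p, hp, (he.le_iff.2 hpr).trans hle⟩

theorem isAtomic (he : IsCompletion e) [IsAtomic B] : IsAtomic A where
  eq_bot_or_exists_atom_le s := or_iff_not_imp_left.2 fun hs => by
    obtain ⟨p, hp, hle⟩ := he.exists_atom_le hs
    exact ⟨e p, he.isAtom hp, hle⟩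

theorem exists_eq_of_isAtom (he : IsCompletion e) [IsAtomic B] {s : A}
    (hs : IsAtom s) : ∃ p, IsAtom p ∧ e p = s := by
  obtain ⟨p, hp, hle⟩ := he.exists_atom_le hs.1
  exact ⟨p, hp, IsAtom.eq_of_le (he.isAtom hp) hs hle⟩

theorem atom_le_rmul_iff (he : IsCompletion e) [IsAtomic B] {p : B} {s t : A} (hp : IsAtom p) :
    e p ≤ s ⨾ t ↔ ∃ q r, IsAtom q ∧ IsAtom r ∧ e q ≤ s ∧ e r ≤ t ∧ p ≤ q ⨾ r := by
  have := he.isAtomic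
  rw [RelationAlgebra.atom_le_rmul_iff (he.isAtom hp)]
  constructor
  · rintro ⟨q, r, hq, hr, hqs, hrt, h⟩
    obtain ⟨q, hq', rfl⟩ := he.exists_eq_of_isAtom hq
    obtain ⟨r, hr', rfl⟩ := he.exists_eq_of_isAtom hr
    rw [← he.map_rmul, he.le_iff] at h
    exact ⟨q, r, hq', hr', hqs, hrt, h⟩
  · rintro ⟨q, r, hq, hr, hqs, hrt, h⟩
    rw [← he.le_iff, he.map_rmul] at h
    exact ⟨e q, e r, he.isAtom hq, he.isAtom hr, hqs, hrt, h⟩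

end IsCompletion

/-! ### The labelling of pairs of group elements by atoms. -/

section Cells

variable {B : Type u} [RelationAlgebra B]

theorem IsMeasurable.exists_inRect_of_isAtom (hB : IsMeasurable B) {p : B} (hp : IsAtom p) :
    ∃ x y : MeasAtom B, InRect x y p := by
  obtain ⟨x, y, s, hs, hle, h⟩ := hB.exists_inRect hp.1
  rw [(hp.le_iff.1 hle).resolve_left hs] at h
  exact ⟨x, y, h⟩

/-- Each factor lies in some rectangle. Different inner sides would make the product zero, and the
outer sides are forced because a non-zero element lies in only one rectangle. -/
theorem IsMeasurable.exists_inRect_of_le_rmul (hB : IsMeasurable B) {x z : MeasAtom B} {p q r : B}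
    (hp : InRect x z p) (hp0 : p ≠ ⊥) (hq : IsAtom q) (hr : IsAtom r) (h : p ≤ q ⨾ r) :
    ∃ y, InRect x y q ∧ InRect y z r := by
  obtain ⟨x', y, hq⟩ := hB.exists_inRect_of_isAtom hq
  obtain ⟨y', z', hr⟩ := hB.exists_inRect_of_isAtom hr
  have hy : y = y' := by
    by_contra hne
    apply hp0
    rw [← le_bot_iff]
    refine h.trans ?_
    rw [← hq.2, ← hr.1, rmul_assoc, ← rmul_assoc q, MeasAtom.rmul_eq_bot hne, rmul_bot, bot_rmul]
  subst hy
  obtain ⟨rfl, rfl⟩ := hp.unique ((hq.rmul hr).mono h) hp0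
  exact ⟨y, hq, hr⟩

variable {a : ∀ x y : MeasAtom B, Linked x y → B}

/-- A non-zero element has a non-zero part in some rectangle, and some translate of the scaffold
atom lies below that part. -/
theorem IsScaffold.isAtomic (ha : IsScaffold a) (hB : IsMeasurable B) : IsAtomic B where
  eq_bot_or_exists_atom_le s := or_iff_not_imp_left.2 fun hs => by
    obtain ⟨x, y, r, hr, hrs, h⟩ := hB.exists_inRect hs
    have hxy := linked_iff.2 ⟨r, hr, h⟩
    obtain ⟨f, hf⟩ := exists_rmul_le h (ha.inRect hxy) hr (ha.atom _ _ _)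
    exact ⟨_, f.isAtom_rmul (ha.inRect hxy) (ha.atom _ _ _), hf.trans hrs⟩

variable {x y z : MeasAtom B}

variable (a) in
/-- The atom relating the points `f` and `g` of the base set. -/
def cell (h : Linked x y) (f : AtomGroup x) (g : AtomGroup y) : B :=
  f⁻¹.1 ⨾ a x y h ⨾ g.1

theorem inRect_cell (ha : IsScaffold a) (h : Linked x y) (f : AtomGroup x) (g : AtomGroup y) :
    InRect x y (cell a h f g) := (f⁻¹.inRect.rmul (ha.inRect h)).rmul g.inRect

theorem isAtom_cell (ha : IsScaffold a) (h : Linked x y) (f : AtomGroup x) (g : AtomGroup y) :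
    IsAtom (cell a h f g) :=
  g.isAtom_rmul_right (f⁻¹.inRect.rmul (ha.inRect h))
    (f⁻¹.isAtom_rmul (ha.inRect h) (ha.atom _ _ h))

theorem exists_cell_eq (ha : IsScaffold a) (h : Linked x y) {p : B} (hp : IsAtom p)
    (hr : InRect x y p)
    (f : AtomGroup x) : ∃ g, cell a h f g = p :=
  exists_rmul_eq_right hr (f⁻¹.inRect.rmul (ha.inRect h)) hp
    (f⁻¹.isAtom_rmul (ha.inRect h) (ha.atom _ _ h))

theorem conv_cell (ha : IsScaffold a) (h : Linked x y) (f : AtomGroup x) (g : AtomGroup y) :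
    (cell a h f g)˘ = cell a (linked_equivalence.symm h) g f := by
  unfold cell
  rw [conv_rmul, conv_rmul, ha.symm' h, AtomGroup.coe_inv, AtomGroup.coe_inv, conv_conv,
    rmul_assoc]

/-- The inner g;g⁻¹ cancels, leaving the scaffold law translated by f⁻¹ and h. -/
theorem cell_le_rmul_cell (ha : IsScaffold a) (hxy : Linked x y) (hyz : Linked y z)
    (hxz : Linked x z)
    (f : AtomGroup x) (g : AtomGroup y) (h : AtomGroup z) :
    cell a hxz f h ≤ cell a hxy f g ⨾ cell a hyz g h := by
  have h1 : cell a hxy f g ⨾ cell a hyz g h =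
      f⁻¹.1 ⨾ (a x y hxy ⨾ a y z hyz) ⨾ h.1 := by
    unfold cell
    rw [rmul_assoc, rmul_assoc, AtomGroup.rmul_rmul_right, mul_inv_cancel, AtomGroup.coe_one,
      ← rmul_assoc _ _ y.1, (ha.inRect hxy).2, rmul_assoc]
  rw [h1]
  exact rmul_mono_left (rmul_mono_right _ (ha.comp _ _ _ _ _ _)) _

/-- Transitivity gives g with the correct first label, and g may still be changed by K_xy on the
left. That freedom suffices to correct the second label: g;r;h⁻¹ lies below a_yx;a_xz, hence equals
k;a_yz with k in H_yx = K_xy. -/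
theorem exists_cell_of_le_rmul (ha : IsScaffold a) (hxy : Linked x y) (hyz : Linked y z)
    (hxz : Linked x z)
    {f : AtomGroup x} {h : AtomGroup z} {q r : B} (hq : IsAtom q) (hr : IsAtom r)
    (hqr : InRect x y q) (hrr : InRect y z r) (hle : cell a hxz f h ≤ q ⨾ r) :
    ∃ g, cell a hxy f g = q ∧ cell a hyz g h = r := by
  obtain ⟨g, rfl⟩ := exists_cell_eq ha hxy hq hqr f
  have hgr : InRect y z (g.1 ⨾ r ⨾ h⁻¹.1) := (g.inRect.rmul hrr).rmul h⁻¹.inRect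
  have hga : IsAtom (g.1 ⨾ r ⨾ h⁻¹.1) :=
    h⁻¹.isAtom_rmul_right (g.inRect.rmul hrr) (g.isAtom_rmul hrr hr)
  have h1 : a x z hxz ≤ a x y hxy ⨾ (g.1 ⨾ r ⨾ h⁻¹.1) := by
    have := rmul_mono_left (rmul_mono_right f.1 hle) h⁻¹.1
    unfold cell at this
    simp only [rmul_assoc] at this ⊢
    rw [← AtomGroup.coe_mul f, mul_inv_cancel, AtomGroup.coe_one, (ha.inRect hxy).1,
      (ha.inRect hxz).1, AtomGroup.rmul_rmul_right, mul_inv_cancel, AtomGroup.coe_one,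
      (ha.inRect hxz).2] at this
    exact this
  have h2 : g.1 ⨾ r ⨾ h⁻¹.1 ≤ a y x (linked_equivalence.symm hxy) ⨾ a x z hxz := by
    apply le_of_not_disjoint hga
    rw [ha.symm' hxy, disjoint_comm, ← disjoint_rmul_iff_left, disjoint_comm]
    exact not_disjoint_of_le (ha.atom _ _ _).1 h1
  obtain ⟨k, hk, hk'⟩ := ha.exists_of_le_comp hga _ _ hyz h2
  have hk2 : a x y hxy ⨾ k⁻¹.1 = a x y hxy := by
    apply conv_injective
    rw [conv_rmul, ← ha.symm' hxy, ← AtomGroup.coe_inv, inv_inv, hk]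
  -- Since k fixes a_xy on the right, the first label is unchanged; the second becomes g⁻¹;k;a_yz;h
  -- = r.
  refine ⟨k⁻¹ * g, ?_, ?_⟩
  · unfold cell
    rw [AtomGroup.coe_mul, rmul_assoc, ← rmul_assoc _ _ k⁻¹.1, hk2]
  · unfold cell
    rw [mul_inv_rev, inv_inv, AtomGroup.coe_mul, ← rmul_assoc g⁻¹.1, hk']
    rw [← rmul_assoc, AtomGroup.rmul_rmul_right, inv_mul_cancel, AtomGroup.coe_one,
      (g.inRect.rmul hrr).2, AtomGroup.rmul_rmul, inv_mul_cancel, AtomGroup.coe_one, hrr.1]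

theorem cell_le_ident_iff (ha : IsScaffold a) (h : Linked x y) (f : AtomGroup x) (g : AtomGroup y) :
    cell a h f g ≤ ident ↔ (⟨x, f⟩ : Σ x : MeasAtom B, AtomGroup x) = ⟨y, g⟩ := by
  constructor
  · intro hle
    have hr := inRect_cell ha h f g
    have h0 := (isAtom_cell ha h f g).1
    have hxy : x = y := by
      by_contra hne
      apply h0
      have h1 : x.1 ⨾ cell a h f g ⨾ y.1 ≤ x.1 ⨾ ident ⨾ y.1 :=
        rmul_mono_left (rmul_mono_right _ hle) _
      rwa [hr.1, hr.2, rmul_ident, MeasAtom.rmul_eq_bot hne, le_bot_iff] at h1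
    subst hxy
    have h1 : (f⁻¹ * g).1 ≤ x.1 := by
      have h2 : x.1 ⨾ cell a h f g ≤ x.1 ⨾ ident := rmul_mono_right _ hle
      rw [rmul_ident, hr.1] at h2
      unfold cell at h2
      rwa [ha.diag, f⁻¹.inRect.2] at h2
    have h2 : f⁻¹ * g = 1 :=
      AtomGroup.coe_inj.1 (IsAtom.eq_of_le (f⁻¹ * g).isAtom x.isAtom h1)
    rw [inv_mul_eq_one.1 h2]
  · intro heq
    obtain ⟨rfl, heq⟩ := Sigma.mk.inj_iff.1 heq
    obtain rfl := eq_of_heq heq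
    unfold cell
    rw [ha.diag, f⁻¹.inRect.2, ← AtomGroup.coe_mul, inv_mul_cancel]
    exact x.le_ident

end Cells

end RelationAlgebra

namespace RelationAlgebra

/-! ### The representation on the base set, and the shifted product. -/

section Representation

variable {B : Type u} [RelationAlgebra B] {a : ∀ x y : MeasAtom B, Linked x y → B}
  (ha : IsScaffold a) {x y z : MeasAtom B}

/-- If m and n correspond to f and α, then f⁻¹;a_xy;m = a_xy and a_xy;n = α;a_xy, so the label of
(f, mn) is α;a_xy. Thus an atomic relation collects the pairs with one fixed label. -/
theorem mem_atomRel_iff (h : Linked x y) (α : AtomGroup x)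
    (p : (scaffoldPair ha).Base × (scaffoldPair ha).Base) :
    p ∈ (scaffoldPair ha).atomRel h (QuotientGroup.mk α) ↔
      ∃ (f : AtomGroup x) (g : AtomGroup y),
        p = (⟨x, f⟩, ⟨y, g⟩) ∧ cell a h f g = α.1 ⨾ a x y h := by
  constructor
  · rintro ⟨_, f, rfl, _, ⟨m, hm, n, hn, rfl⟩, rfl⟩
    have hm' := (scaffoldPair_φ_iff ha h f m).1 hm.symm
    have hn' := (scaffoldPair_φ_iff ha h α n).1 hn.symm
    refine ⟨f, m * n, rfl, ?_⟩
    change f⁻¹.1 ⨾ a x y h ⨾ (m * n : AtomGroup y).1 = _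
    rw [AtomGroup.coe_mul, rmul_assoc, ← rmul_assoc _ _ m.1, ← hm', AtomGroup.rmul_rmul,
      inv_mul_cancel, AtomGroup.coe_one, (ha.inRect h).1, hn']
  · rintro ⟨f, g, rfl, hfg⟩
    obtain ⟨m, hm⟩ := exists_intertwining_right (ha.inRect h) (ha.atom _ _ h) f
    refine ⟨QuotientGroup.mk f, f, rfl, g, ⟨m, ((scaffoldPair_φ_iff ha h f m).2 hm).symm,
      m⁻¹ * g, ((scaffoldPair_φ_iff ha h α _).2 ?_).symm, mul_inv_cancel_left m g⟩, rfl⟩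
    rw [← hfg, AtomGroup.coe_mul, rmul_assoc]
    unfold cell
    congr 1
    refine (m.rmul_eq_iff_right (f⁻¹.inRect.rmul (ha.inRect h)) (ha.inRect h)).1 ?_
    rw [← rmul_assoc, ← hm, AtomGroup.rmul_rmul, inv_mul_cancel, AtomGroup.coe_one,
      (ha.inRect h).1]

variable {A : Type u} [RelationAlgebra A] (e : B → A)

/-- The representation of a completion on the base set of the group pair of a scaffold. -/
def representation (s : A) : SetRel (scaffoldPair ha).Base (scaffoldPair ha).Base :=
  {p | ∃ h : Linked p.1.1 p.2.1, e (cell a h p.1.2 p.2.2) ≤ s}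

variable {e}

theorem mem_representation_iff (h : Linked x y) (f : AtomGroup x) (g : AtomGroup y) (s : A) :
    ((⟨x, f⟩, ⟨y, g⟩) : (scaffoldPair ha).Base × (scaffoldPair ha).Base) ∈
      representation ha e s ↔ e (cell a h f g) ≤ s :=
  ⟨fun ⟨_, h⟩ => h, fun h' => ⟨h, h'⟩⟩

theorem representation_injective (hB : IsMeasurable B) (he : IsCompletion e) :
    Function.Injective (representation ha e) := by
  have := ha.isAtomic hB
  have := he.isAtomic
  have key : ∀ s t : A, representation ha e s ⊆ representation ha e t → s ≤ t := by
    intro s t hst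
    refine le_of_forall_atom_le fun p hp hps => ?_
    obtain ⟨p, hp', rfl⟩ := he.exists_eq_of_isAtom hp
    obtain ⟨x, y, hr⟩ := hB.exists_inRect_of_isAtom hp'
    have h := linked_iff.2 ⟨p, hp'.1, hr⟩
    -- Each atom already occurs as the label of a pair whose first point is the identity of G_x.
    obtain ⟨g, rfl⟩ := exists_cell_eq ha h hp' hr 1
    exact (mem_representation_iff ha h 1 g t).1
      (hst ((mem_representation_iff ha h 1 g s).2 hps))
  exact fun s t h => le_antisymm (key s t h.subset) (key t s h.symm.subset)

theorem range_representation (he : IsCompletion e) :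
    Set.range (representation ha e) = (scaffoldPair ha).relUniverse := by
  ext R
  constructor
  · rintro ⟨s, rfl⟩
    refine ⟨{R | ∃ (x y : MeasAtom B) (h : Linked x y) (α : AtomGroup x),
      R = (scaffoldPair ha).atomRel h (QuotientGroup.mk α) ∧ e (α.1 ⨾ a x y h) ≤ s}, ?_, ?_⟩
    · rintro _ ⟨x, y, h, α, rfl, -⟩
      exact ⟨x, y, h, _, rfl⟩
    · ext p
      constructor
      · obtain ⟨⟨x, f⟩, ⟨y, g⟩⟩ := p
        rintro ⟨h, hle⟩
        obtain ⟨α, hα⟩ := exists_rmul_eq (inRect_cell ha h f g) (ha.inRect h)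
          (isAtom_cell ha h f g) (ha.atom _ _ h)
        exact ⟨_, ⟨x, y, h, α, rfl, hα ▸ hle⟩,
          (mem_atomRel_iff ha h α _).2 ⟨f, g, rfl, hα.symm⟩⟩
      · rintro ⟨_, ⟨x, y, h, α, rfl, hle⟩, hp⟩
        obtain ⟨f, g, rfl, hc⟩ := (mem_atomRel_iff ha h α _).1 hp
        exact (mem_representation_iff ha h f g s).2 (hc ▸ hle)
  · rintro ⟨T, hT, rfl⟩
    -- The preimage of a union of atomic relations is the supremum of the corresponding atoms; an
    -- atom below that supremum is already one of them, so no further pairs appear.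
    obtain ⟨s, hs⟩ := he.complete {t | ∃ (x y : MeasAtom B) (h : Linked x y) (α : AtomGroup x),
      (scaffoldPair ha).atomRel h (QuotientGroup.mk α) ∈ T ∧ t = e (α.1 ⨾ a x y h)}
    refine ⟨s, ?_⟩
    ext p
    constructor
    · obtain ⟨⟨x, f⟩, ⟨y, g⟩⟩ := p
      rintro ⟨h, hle⟩
      change AtomGroup x at f
      change AtomGroup y at g
      obtain ⟨_, ⟨x', y', h', α, hα, rfl⟩, hq⟩ :=
        atom_le_lub (he.isAtom (isAtom_cell ha h f g)) hs hle
      have heq := IsAtom.eq_of_le (isAtom_cell ha h f g)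
        (α.isAtom_rmul (ha.inRect h') (ha.atom _ _ h')) (he.le_iff.1 hq)
      obtain ⟨rfl, rfl⟩ := (inRect_cell ha h f g).unique
        (heq ▸ α.inRect.rmul (ha.inRect h')) (isAtom_cell ha h f g).1
      exact ⟨_, hα, (mem_atomRel_iff ha h' α _).2 ⟨f, g, rfl, heq⟩⟩
    · rintro ⟨R, hR, hp⟩
      obtain ⟨x, y, h, α, rfl⟩ := hT hR
      obtain ⟨α, rfl⟩ := QuotientGroup.mk_surjective α
      obtain ⟨f, g, rfl, hc⟩ := (mem_atomRel_iff ha h α _).1 hp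
      refine (mem_representation_iff ha h f g s).2 ?_
      rw [hc]
      exact hs.1 ⟨x, y, h, α, hR, rfl⟩

theorem representation_isSetIso (hB : IsMeasurable B) (he : IsCompletion e) :
    IsSetIso (representation ha e) (scaffoldPair ha).unit (scaffoldPair ha).relUniverse where
  injective := representation_injective ha hB he
  range_eq := range_representation ha he
  map_sup s t := by
    ext ⟨⟨x, f⟩, ⟨y, g⟩⟩
    constructor
    · rintro ⟨h, hle⟩
      exact ((atom_le_sup_iff (he.isAtom (isAtom_cell ha h f g))).1 hle).imp
        (fun h' => ⟨h, h'⟩) (fun h' => ⟨h, h'⟩)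
    · rintro (⟨h, hle⟩ | ⟨h, hle⟩)
      · exact ⟨h, le_sup_of_le_left hle⟩
      · exact ⟨h, le_sup_of_le_right hle⟩
  map_compl s := by
    ext ⟨⟨x, f⟩, ⟨y, g⟩⟩
    constructor
    · rintro ⟨h, hle⟩
      exact ⟨h, fun ⟨_, h'⟩ => (atom_le_compl_iff (he.isAtom (isAtom_cell ha h f g))).1 hle h'⟩
    · rintro ⟨h, hn⟩
      exact ⟨h, (atom_le_compl_iff (he.isAtom (isAtom_cell ha h f g))).2 fun h' => hn ⟨h, h'⟩⟩
  map_rmul s t := by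
    have := ha.isAtomic hB
    ext ⟨⟨x, f⟩, ⟨z, k⟩⟩
    constructor
    · rintro ⟨h, hle⟩
      obtain ⟨q, r, hq, hr, hqs, hrt, hle⟩ :=
        (he.atom_le_rmul_iff (isAtom_cell ha h f k)).1 hle
      obtain ⟨y, hqr, hrr⟩ := hB.exists_inRect_of_le_rmul (inRect_cell ha h f k)
        (isAtom_cell ha h f k).1 hq hr hle
      have hxy := linked_iff.2 ⟨q, hq.1, hqr⟩
      have hyz := linked_iff.2 ⟨r, hr.1, hrr⟩
      obtain ⟨g, rfl, rfl⟩ := exists_cell_of_le_rmul ha hxy hyz h hq hr hqr hrr hle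
      exact ⟨⟨y, g⟩, ⟨hxy, hqs⟩, ⟨hyz, hrt⟩⟩
    · rintro ⟨⟨y, g⟩, ⟨hxy, hqs⟩, ⟨hyz, hrt⟩⟩
      refine ⟨linked_equivalence.trans hxy hyz, ?_⟩
      exact (he.atom_le_rmul_iff (isAtom_cell ha _ f k)).2 ⟨_, _, isAtom_cell ha hxy f g,
        isAtom_cell ha hyz g k, hqs, hrt, cell_le_rmul_cell ha _ _ _ f g k⟩
  map_conv s := by
    ext ⟨⟨x, f⟩, ⟨y, g⟩⟩
    have key (h : Linked x y) : e (cell a h f g) ≤ s˘ ↔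
        e (cell a (linked_equivalence.symm h) g f) ≤ s := by
      rw [← conv_cell ha h f g, he.map_conv, conv_le_iff]
    exact ⟨fun ⟨h, hle⟩ => ⟨linked_equivalence.symm h, (key h).1 hle⟩,
      fun ⟨h, hle⟩ => ⟨linked_equivalence.symm h, (key _).2 hle⟩⟩
  map_ident := by
    ext ⟨⟨x, f⟩, ⟨y, g⟩⟩
    rw [← he.map_ident]
    constructor
    · rintro ⟨h, hle⟩
      exact (cell_le_ident_iff ha h f g).1 (he.le_iff.1 hle)
    · intro heq
      have hxy : x = y := congrArg Sigma.fst heq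
      have h : Linked x y := hxy ▸ linked_equivalence.refl x
      exact ⟨h, he.le_iff.2 ((cell_le_ident_iff ha h f g).2 heq)⟩

theorem essentiallyIsomorphic_scaffoldPair (hB : IsMeasurable B) :
    EssentiallyIsomorphic B (scaffoldPair ha).unit (scaffoldPair ha).relUniverse := by
  have := ha.isAtomic hB
  exact ⟨⟨_, atomComplexAlgebra B, _, isCompletion_atomComplex B⟩,
    fun A _ e he => ⟨_, representation_isSetIso ha hB he⟩⟩

/-- The cosets occurring in the shifted product of two atomic relations. -/
theorem cosetH_subset_iff (hxy : Linked x y) (hyz : Linked y z) (α γ : AtomGroup x)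
    (β : AtomGroup y) :
    (scaffoldPair ha).cosetH (linked_equivalence.trans hxy hyz) (QuotientGroup.mk γ) ⊆
        (scaffoldPair ha).preimage hxy ((scaffoldPair ha).cosetK hxy (QuotientGroup.mk α) *
          (scaffoldPair ha).cosetH hyz (QuotientGroup.mk β)) * (scaffoldPair ha).HH hxy hyz ↔
      γ.1 ⨾ a x z (linked_equivalence.trans hxy hyz) ≤
        α.1 ⨾ a x y hxy ⨾ (β.1 ⨾ a y z hyz) := by
  rw [← coe_supStabilizer]
  constructor
  · intro h
    obtain ⟨f, ⟨_, ⟨m, hm, n, hn, rfl⟩, hf⟩, u, hu, hγ⟩ := h (show γ ∈ _ from rfl)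
    have hm' := (scaffoldPair_φ_iff ha hxy α m).1 hm.symm
    have hf' := (scaffoldPair_φ_iff ha hxy f (m * n : AtomGroup y)).1 hf
    have hn' := (mk_eq_mk_iff_left (ha.inRect hyz) n β).1 hn
    have hu' := (mem_supStabilizer_iff ha hxy hyz u).1 hu
    have hγ' : γ = f * u := hγ.symm
    rw [hγ', ← hn', hm', AtomGroup.coe_mul, ← rmul_assoc]
    refine (rmul_mono_right _ hu').trans (le_of_eq ?_)
    rw [rmul_assoc, hf', AtomGroup.coe_mul]
    simp only [rmul_assoc]
  · intro h γ' hγ'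
    have hγ' := (mk_eq_mk_iff_left (ha.inRect _) γ' γ).1 hγ'
    obtain ⟨m, hm⟩ := exists_intertwining_right (ha.inRect hxy) (ha.atom _ _ _) α
    obtain ⟨f, hf⟩ := exists_intertwining_left (ha.inRect hxy) (ha.atom _ _ _) (m * β)
    refine ⟨f, ⟨m * β, ⟨m, ((scaffoldPair_φ_iff ha hxy α m).2 hm).symm, β, rfl, rfl⟩,
      (scaffoldPair_φ_iff ha hxy f _).2 hf⟩, f⁻¹ * γ', ?_, mul_inv_cancel_left f γ'⟩
    refine (mem_supStabilizer_iff ha hxy hyz (f⁻¹ * γ')).2 ?_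
    change AtomGroup x at γ'
    rw [← AtomGroup.rmul_rmul, hγ', AtomGroup.rmul_le_iff _ (γ.inRect.rmul (ha.inRect _))
      ((ha.inRect _).rmul (ha.inRect _)), inv_inv, rmul_assoc, hf, AtomGroup.coe_mul]
    rw [hm] at h
    simpa only [rmul_assoc] using h

/-- With C = H_xy∘H_xz, the coset condition defining ⊗ says that one label lies below the product of
two others. Splitting labels gives one inclusion and composing them the other. -/
theorem otimes_eq_comp {R S : SetRel (scaffoldPair ha).Base (scaffoldPair ha).Base}
    (hR : R ∈ (scaffoldPair ha).relUniverse) (hS : S ∈ (scaffoldPair ha).relUniverse) :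
    (scaffoldTriple ha).otimes R S = SetRel.comp R S := by
  ext p
  constructor
  · rintro ⟨x, y, z, hxy, hyz, α, β, hα, hβ, hp⟩
    obtain ⟨α, rfl⟩ := QuotientGroup.mk_surjective α
    obtain ⟨β, rfl⟩ := QuotientGroup.mk_surjective β
    obtain ⟨γ, hγ, hp⟩ := Set.mem_iUnion₂.1 hp
    obtain ⟨γ, rfl⟩ := QuotientGroup.mk_surjective γ
    obtain ⟨f, k, rfl, hc⟩ := (mem_atomRel_iff ha _ γ _).1 hp
    have hle := (cosetH_subset_iff ha hxy hyz α γ β).1 hγ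
    rw [← hc] at hle
    obtain ⟨g, hq, hr⟩ := exists_cell_of_le_rmul ha hxy hyz _
      (AtomGroup.isAtom_rmul α (ha.inRect hxy) (ha.atom _ _ _))
      (AtomGroup.isAtom_rmul β (ha.inRect hyz) (ha.atom _ _ _))
      ((AtomGroup.inRect α).rmul (ha.inRect hxy)) ((AtomGroup.inRect β).rmul (ha.inRect hyz)) hle
    exact ⟨⟨y, g⟩, hα ((mem_atomRel_iff ha hxy α _).2 ⟨f, g, rfl, hq⟩),
      hβ ((mem_atomRel_iff ha hyz β _).2 ⟨g, k, rfl, hr⟩)⟩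
  · obtain ⟨⟨x, f⟩, ⟨z, k⟩⟩ := p
    rintro ⟨⟨y, g⟩, hfg, hgk⟩
    -- In a union of atomic relations, each pair comes with the whole atomic relation of its label;
    -- this is where membership in the universe is needed.
    have key : ∀ {R : SetRel (scaffoldPair ha).Base (scaffoldPair ha).Base},
        R ∈ (scaffoldPair ha).relUniverse → ∀ {x y : MeasAtom B} {f : AtomGroup x}
        {g : AtomGroup y}, (((⟨x, f⟩, ⟨y, g⟩) :
          (scaffoldPair ha).Base × (scaffoldPair ha).Base) ∈ R) →
        ∃ (h : Linked x y) (α : AtomGroup x),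
          (scaffoldPair ha).atomRel h (QuotientGroup.mk α) ⊆ R ∧
          cell a h f g = α.1 ⨾ a x y h := by
      rintro _ ⟨T, hT, rfl⟩ x y f g ⟨Q, hQ, hmem⟩
      obtain ⟨x', y', h, α, rfl⟩ := hT hQ
      obtain ⟨α, rfl⟩ := QuotientGroup.mk_surjective α
      obtain ⟨f', g', heq, hc⟩ := (mem_atomRel_iff ha h α _).1 hmem
      cases heq
      exact ⟨h, α, Set.subset_sUnion_of_mem hQ, hc⟩
    obtain ⟨hxy, α, hα, hq⟩ := key hR hfg
    obtain ⟨hyz, β, hβ, hr⟩ := key hS hgk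
    have hxz := linked_equivalence.trans hxy hyz
    obtain ⟨γ, hγ⟩ := exists_rmul_eq (inRect_cell ha hxz f k) (ha.inRect hxz)
      (isAtom_cell ha hxz f k) (ha.atom _ _ _)
    refine ⟨x, y, z, hxy, hyz, QuotientGroup.mk α, QuotientGroup.mk β, hα, hβ,
      Set.mem_iUnion₂.2 ⟨QuotientGroup.mk γ, ?_,
        (mem_atomRel_iff ha hxz γ _).2 ⟨f, k, rfl, hγ.symm⟩⟩⟩
    refine (cosetH_subset_iff ha hxy hyz α γ β).2 ?_
    rw [hγ, ← hq, ← hr]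
    exact cell_le_rmul_cell ha _ _ _ f g k

end Representation

end RelationAlgebra

theorem mainTheorem2 {B : Type u} [RelationAlgebra B] (hB : RelationAlgebra.IsMeasurable B)
    (a : ∀ x y : RelationAlgebra.MeasAtom B, RelationAlgebra.Linked x y → B)
    (ha : RelationAlgebra.IsScaffold a) :
    ∃ (F : GroupTriple (RelationAlgebra.MeasAtom B)) (ι : ∀ x, F.G x → B),
      F.IsAssociated a ι ∧ F.IsSemiFrame ∧ F.toGroupPair.IsFrame ∧
      RelationAlgebra.EssentiallyIsomorphic B F.unit F.relUniverse ∧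
      ∀ R ∈ F.relUniverse, ∀ S ∈ F.relUniverse, F.otimes R S = SetRel.comp R S :=
  ⟨RelationAlgebra.scaffoldTriple ha, _, RelationAlgebra.scaffoldTriple_isAssociated ha,
    RelationAlgebra.scaffoldTriple_isSemiFrame ha, RelationAlgebra.scaffoldPair_isFrame ha,
    RelationAlgebra.essentiallyIsomorphic_scaffoldPair ha hB,
    fun _ hR _ hS => RelationAlgebra.otimes_eq_comp ha hR hS⟩
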